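/- A fuzzy number is a function $u:\mathbb R\to[0,1]$ that is normal ($u(t)=1$ for some $t$), fuzzy convex (quasiconcave), upper semicontinuous and has compact support $\overline{\{t:u(t)>0\}}$. Its level sets $[u]_\alpha=\{t:u(t)\ge\alpha\}$ for $0<\alpha\le1$ and $[u]_0=\overline{\{t:u(t)>0\}}$ are compact intervals $[u^-_\alpha,u^+_\alpha]$. Let $\mathbb R_{\mathcal F}$ be the set of fuzzy numbers, with addition $[u+v]_\alpha=[u]_\alpha+[v]_\alpha$, scalar multiplication $[ku]_\alpha=k[u]_\alpha$ ($k\in\mathbb R$), and the metric $D(u,v)=\sup_{\alpha\in[0,1]}\max\{|u^-_\alpha-v^-_\alpha|,|u^+_\alpha-v^+_\alpha|\}$. Let $C^{(\mathcal F)}_{2\pi}(\mathbb R^2)$ be the set of functions $f:\mathbb R^2\to\mathbb R_{\mathcal F}$ that are $D$-continuous and $2\pi$-periodic in each variable, with the metric $D^*(f,g)=\sup_{(x,y)\in\mathbb R^2}D(f(x,y),g(x,y))$. For $m\in\mathbb N=\{0,1,2,\dots\}$ let $$\phi_m(x)=\frac{\sin^2((m+1)x/2)}{(m+1)\sin^2(x/2)}\quad(x\notin2\pi\mathbb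 Z),\qquad \phi_m(x)=m+1\quad(x\in2\pi\mathbb Z).$$ Let $f\in C^{(\mathcal F)}_{2\pi}(\mathbb R^2)$. Then: 1. For all $m,n\in\mathbb N$ and $(x,y)\in\mathbb R^2$ the fuzzy Riemann integral in $$F_{mn}(f;x,y)=\frac1{4\pi^2}\int_{-\pi}^{\pi}\int_{-\pi}^{\pi}f(x-u,y-v)\,\phi_m(u)\phi_n(v)\,du\,dv$$ exists, as the $D$-limit of the Riemann sums over tagged partitions of $[-\pi,\pi]^2$ into rectangles as the mesh tends to $0$, and $F_{mn}(f)\in C^{(\mathcal F)}_{2\pi}(\mathbb R^2)$. 2. $F_{mn}(f)$ is given levelwise by the Cesàro means of the double level Fourier series of $f$: for all $m,n\in\mathbb N$, $(x,y)\in\mathbb R^2$ and $\alpha\in[0,1]$, $$F_{mn}(f;x,y)^{\mp}_\alpha=\frac1{(m+1)(n+1)}\sum_{j=0}^m\sum_{k=0}^n\sum_{p=0}^j\sum_{q=0}^k u^{\mp}_{pq}(\alpha;x,y),$$ where, for $j,k\ge1$, $$u^{\mp}_{00}=\tfrac14a^\mp_{00},\quad u^{\mp}_{j0}=\tfrac12\left(a^\mp_{j0}\cos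 jx+c^\mp_{j0}\sin jx\right),\quad u^{\mp}_{0k}=\tfrac12\left(a^\mp_{0k}\cos ky+b^\mp_{0k}\sin ky\right),$$ $$u^{\mp}_{jk}=a^\mp_{jk}\cos jx\cos ky+b^\mp_{jk}\cos jx\sin ky+c^\mp_{jk}\sin jx\cos ky+d^\mp_{jk}\sin jx\sin ky,$$ and, for $j,k\ge0$, $a^\mp_{jk},b^\mp_{jk},c^\mp_{jk},d^\mp_{jk}$ (which depend on $\alpha$) are the numbers $\frac1{\pi^2}\int_{-\pi}^{\pi}\int_{-\pi}^{\pi}f^\mp_\alpha(s,t)\,\omega(s,t)\,ds\,dt$ with $\omega(s,t)=\cos js\cos kt$, $\cos js\sin kt$, $\sin js\cos kt$, $\sin js\sin kt$, respectively. 3. $F_{mn}(f)\to f$ uniformly: $\lim_{m,n\to\infty}D^*(F_{mn}(f),f)=0$, where $m,n$ tend to infinity independently. -/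

import Mathlib

open Filter Topology
open scoped Pointwise

noncomputable section

/-- A fuzzy number: a normal, fuzzy convex, upper semicontinuous fuzzy set
`u : ℝ → [0,1]` whose support `closure {t | 0 < u t}` is compact. -/
@[ext]
structure FuzzyNumber where
  toFun : ℝ → ℝ
  mem_unit : ∀ t, toFun t ∈ Set.Icc (0 : ℝ) 1
  normal : ∃ t, toFun t = 1
  fuzzyConvex : QuasiconcaveOn ℝ Set.univ toFun
  usc : UpperSemicontinuous toFun
  compact_support : IsCompact (closure {t | 0 < toFun t})

namespace FuzzyNumber

/-- The `α`-level set `[u]_α`, for `α ∈ [0,1]`. -/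
def levelSet (u : FuzzyNumber) (α : ℝ) : Set ℝ :=
  if 0 < α then {t | α ≤ u.toFun t} else closure {t | 0 < u.toFun t}

/-- The left endpoint `u⁻_α` of `[u]_α`. -/
def lower (u : FuzzyNumber) (α : ℝ) : ℝ := sInf (u.levelSet α)

/-- The right endpoint `u⁺_α` of `[u]_α`. -/
def upper (u : FuzzyNumber) (α : ℝ) : ℝ := sSup (u.levelSet α)

theorem mem_levelSet (u : FuzzyNumber) {α t : ℝ} (h : 0 < α) :
    t ∈ u.levelSet α ↔ α ≤ u.toFun t := by
  simp [levelSet, h]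

theorem levelSet_anti (u : FuzzyNumber) {α β : ℝ} (h : α ≤ β) :
    u.levelSet β ⊆ u.levelSet α := by
  intro t ht
  by_cases hα : 0 < α
  · rw [mem_levelSet u hα]
    exact h.trans ((mem_levelSet u (hα.trans_le h)).1 ht)
  · by_cases hβ : 0 < β
    · simp only [levelSet, hα, if_false]
      exact subset_closure (hβ.trans_le ((mem_levelSet u hβ).1 ht))
    · simpa [levelSet, hα, hβ] using ht

theorem levelSet_nonempty (u : FuzzyNumber) {α : ℝ} (h : α ≤ 1) :
    (u.levelSet α).Nonempty := by
  obtain ⟨t, ht⟩ := u.normal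
  exact ⟨t, levelSet_anti u h ((mem_levelSet u one_pos).2 ht.ge)⟩

theorem isClosed_levelSet (u : FuzzyNumber) (α : ℝ) : IsClosed (u.levelSet α) := by
  unfold levelSet
  split_ifs
  · exact u.usc.isClosed_preimage α
  · exact isClosed_closure

theorem levelSet_subset_zero (u : FuzzyNumber) (α : ℝ) :
    u.levelSet α ⊆ u.levelSet 0 := by
  by_cases hα : 0 < α
  · exact levelSet_anti u hα.le
  · simp [levelSet, hα]

theorem isCompact_levelSet (u : FuzzyNumber) (α : ℝ) : IsCompact (u.levelSet α) := by
  have h0 : IsCompact (u.levelSet 0) := by simpa [levelSet] using u.compact_support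
  exact h0.of_isClosed_subset (isClosed_levelSet u α) (levelSet_subset_zero u α)

theorem convex_levelSet (u : FuzzyNumber) (α : ℝ) : Convex ℝ (u.levelSet α) := by
  unfold levelSet
  split_ifs
  · simpa using u.fuzzyConvex α
  · have := u.fuzzyConvex.convex_gt 0
    simp only [Set.mem_univ, true_and] at this
    exact this.closure

theorem levelSet_eq_Icc (u : FuzzyNumber) {α : ℝ} (h : α ≤ 1) :
    u.levelSet α = Set.Icc (u.lower α) (u.upper α) :=
  eq_Icc_of_connected_compact
    ⟨levelSet_nonempty u h, (convex_levelSet u α).isPreconnected⟩ (isCompact_levelSet u α)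

theorem ext_levelSet {u v : FuzzyNumber}
    (h : ∀ α ∈ Set.Ioc (0 : ℝ) 1, u.levelSet α = v.levelSet α) : u = v := by
  have key : ∀ {u v : FuzzyNumber},
      (∀ α ∈ Set.Ioc (0 : ℝ) 1, u.levelSet α = v.levelSet α) →
      ∀ t, u.toFun t ≤ v.toFun t := by
    intro u v h t
    by_cases ht : 0 < u.toFun t
    · have h1 : t ∈ u.levelSet (u.toFun t) := (mem_levelSet u ht).2 le_rfl
      rw [h _ ⟨ht, (u.mem_unit t).2⟩] at h1
      exact (mem_levelSet v ht).1 h1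
    · exact (not_lt.1 ht).trans (v.mem_unit t).1
  ext t
  exact le_antisymm (key h t) (key (fun α hα => (h α hα).symm) t)

/-- The data of a decreasing, left continuous family of compact intervals. -/
structure IsLevelFamily (A : ℝ → Set ℝ) : Prop where
  nonempty : (A 1).Nonempty
  closed : ∀ α ∈ Set.Ioc (0 : ℝ) 1, IsClosed (A α)
  convex : ∀ α ∈ Set.Ioc (0 : ℝ) 1, Convex ℝ (A α)
  anti : ∀ α ∈ Set.Ioc (0 : ℝ) 1, ∀ β ∈ Set.Ioc (0 : ℝ) 1, α ≤ β → A β ⊆ A α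
  left : ∀ α ∈ Set.Ioc (0 : ℝ) 1, ∀ t, (∀ β ∈ Set.Ioo (0 : ℝ) α, t ∈ A β) → t ∈ A α
  bounded : ∃ K, IsCompact K ∧ ∀ α ∈ Set.Ioc (0 : ℝ) 1, A α ⊆ K

/-- `t ↦ sup {α ∈ (0,1] : t ∈ A α}`. -/
def supLevel (A : ℝ → Set ℝ) (t : ℝ) : ℝ := sSup {α | α ∈ Set.Ioc (0 : ℝ) 1 ∧ t ∈ A α}

theorem supLevel_mem (A : ℝ → Set ℝ) (t : ℝ) : supLevel A t ∈ Set.Icc (0 : ℝ) 1 :=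
  ⟨Real.sSup_nonneg fun _ h => h.1.1.le, Real.sSup_le (fun _ h => h.1.2) zero_le_one⟩

theorem le_supLevel_iff {A : ℝ → Set ℝ} (hA : IsLevelFamily A) {α : ℝ}
    (hα : α ∈ Set.Ioc (0 : ℝ) 1) (t : ℝ) : α ≤ supLevel A t ↔ t ∈ A α := by
  constructor
  · intro h
    refine hA.left α hα t fun β hβ => ?_
    have hne : {α | α ∈ Set.Ioc (0 : ℝ) 1 ∧ t ∈ A α}.Nonempty := by
      by_contra hne
      rw [Set.not_nonempty_iff_eq_empty] at hne
      rw [supLevel, hne, Real.sSup_empty] at h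
      exact absurd hα.1 (not_lt.2 h)
    obtain ⟨γ, hγ, hlt⟩ := exists_lt_of_lt_csSup hne (hβ.2.trans_le h)
    exact hA.anti β ⟨hβ.1, hβ.2.le.trans hα.2⟩ γ hγ.1 hlt.le hγ.2
  · intro h
    exact le_csSup ⟨1, fun _ h => h.1.2⟩ ⟨hα, h⟩

theorem supLevel_pos {A : ℝ → Set ℝ} {t : ℝ} (h : 0 < supLevel A t) :
    ∃ α ∈ Set.Ioc (0 : ℝ) 1, t ∈ A α := by
  by_contra! hne
  have : {α | α ∈ Set.Ioc (0 : ℝ) 1 ∧ t ∈ A α} = ∅ :=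
    Set.eq_empty_of_forall_notMem fun α hα => hne α hα.1 hα.2
  rw [supLevel, this, Real.sSup_empty] at h
  exact lt_irrefl _ h

/-- The fuzzy number with level sets `A α`, `α ∈ (0,1]`. -/
def ofLevels (A : ℝ → Set ℝ) (hA : IsLevelFamily A) : FuzzyNumber where
  toFun := supLevel A
  mem_unit := supLevel_mem A
  normal := by
    obtain ⟨t, ht⟩ := hA.nonempty
    exact ⟨t, le_antisymm (supLevel_mem A t).2
      ((le_supLevel_iff hA ⟨one_pos, le_rfl⟩ t).2 ht)⟩
  fuzzyConvex := by
    intro r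
    simp only [Set.mem_univ, true_and]
    rcases le_or_gt r 0 with hr | hr
    · have : {x | r ≤ supLevel A x} = Set.univ :=
        Set.eq_univ_of_forall fun x => hr.trans (supLevel_mem A x).1
      rw [this]
      exact convex_univ
    · rcases le_or_gt r 1 with hr1 | hr1
      · have : {x | r ≤ supLevel A x} = A r := Set.ext fun x => le_supLevel_iff hA ⟨hr, hr1⟩ x
        rw [this]
        exact hA.convex r ⟨hr, hr1⟩
      · have : {x | r ≤ supLevel A x} = ∅ := Set.eq_empty_of_forall_notMem fun x hx =>
          absurd (hr1.trans_le hx) (not_lt.2 (supLevel_mem A x).2)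
        rw [this]
        exact convex_empty
  usc := by
    rw [upperSemicontinuous_iff_isClosed_preimage]
    intro r
    rcases le_or_gt r 0 with hr | hr
    · have : supLevel A ⁻¹' Set.Ici r = Set.univ :=
        Set.eq_univ_of_forall fun x => hr.trans (supLevel_mem A x).1
      rw [this]
      exact isClosed_univ
    · rcases le_or_gt r 1 with hr1 | hr1
      · have : supLevel A ⁻¹' Set.Ici r = A r :=
          Set.ext fun x => le_supLevel_iff hA ⟨hr, hr1⟩ x
        rw [this]
        exact hA.closed r ⟨hr, hr1⟩
      · have : supLevel A ⁻¹' Set.Ici r = ∅ := Set.eq_empty_of_forall_notMem fun x hx =>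
          absurd (hr1.trans_le hx) (not_lt.2 (supLevel_mem A x).2)
        rw [this]
        exact isClosed_empty
  compact_support := by
    obtain ⟨K, hK, hsub⟩ := hA.bounded
    refine hK.of_isClosed_subset isClosed_closure (closure_minimal ?_ hK.isClosed)
    intro t ht
    obtain ⟨α, hα, htA⟩ := supLevel_pos ht
    exact hsub α hα htA

theorem levelSet_ofLevels {A : ℝ → Set ℝ} (hA : IsLevelFamily A) {α : ℝ}
    (hα : α ∈ Set.Ioc (0 : ℝ) 1) : (ofLevels A hA).levelSet α = A α :=
  Set.ext fun t => (mem_levelSet _ hα.1).trans (le_supLevel_iff hA hα t)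

theorem mem_levelSet_of_forall_lt (u : FuzzyNumber) {α t : ℝ} (hα : 0 < α)
    (h : ∀ β ∈ Set.Ioo (0 : ℝ) α, t ∈ u.levelSet β) : t ∈ u.levelSet α := by
  rw [mem_levelSet u hα]
  refine le_of_forall_lt fun c hc => ?_
  obtain ⟨β, hβ1, hβ2⟩ := exists_between (max_lt hc hα)
  have h0 : 0 < β := (le_max_right _ _).trans_lt hβ1
  exact ((le_max_left _ _).trans_lt hβ1).trans_le ((mem_levelSet u h0).1 (h β ⟨h0, hβ2⟩))

theorem isLevelFamily_add (u v : FuzzyNumber) :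
    IsLevelFamily fun α => u.levelSet α + v.levelSet α where
  nonempty := (levelSet_nonempty u le_rfl).add (levelSet_nonempty v le_rfl)
  closed α _ := ((isCompact_levelSet u α).add (isCompact_levelSet v α)).isClosed
  convex α _ := (convex_levelSet u α).add (convex_levelSet v α)
  anti _ _ _ _ h := Set.add_subset_add (levelSet_anti u h) (levelSet_anti v h)
  bounded := ⟨_, (isCompact_levelSet u 0).add (isCompact_levelSet v 0),
    fun α _ => Set.add_subset_add (levelSet_subset_zero u α) (levelSet_subset_zero v α)⟩
  left := by
    intro α hα t ht
    have : Nonempty (Set.Ioo (0 : ℝ) α) := (Set.nonempty_Ioo.2 hα.1).to_subtype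
    have hcl : ∀ β, IsClosed (u.levelSet β ∩ (fun s => t - s) ⁻¹' v.levelSet β) := fun β =>
      (isClosed_levelSet u β).inter
        ((isClosed_levelSet v β).preimage (continuous_const.sub continuous_id))
    have hne := IsCompact.nonempty_iInter_of_directed_nonempty_isCompact_isClosed
      (fun β : Set.Ioo (0 : ℝ) α => u.levelSet β ∩ (fun s => t - s) ⁻¹' v.levelSet β)
      (by
        intro β γ
        refine ⟨max β γ, ?_, ?_⟩
        · exact Set.inter_subset_inter (levelSet_anti u (le_max_left (β : ℝ) γ))
            (Set.preimage_mono (levelSet_anti v (le_max_left (β : ℝ) γ)))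
        · exact Set.inter_subset_inter (levelSet_anti u (le_max_right (β : ℝ) γ))
            (Set.preimage_mono (levelSet_anti v (le_max_right (β : ℝ) γ))))
      (by
        intro β
        obtain ⟨a, ha, b, hb, hab⟩ := ht β β.2
        refine ⟨a, ha, ?_⟩
        have : t - a = b := by rw [← hab]; ring
        simpa [this] using hb)
      (fun β => (isCompact_levelSet u β).of_isClosed_subset (hcl β) Set.inter_subset_left)
      (fun β => hcl β)
    obtain ⟨s, hs⟩ := hne
    rw [Set.mem_iInter] at hs
    exact ⟨s, mem_levelSet_of_forall_lt u hα.1 fun β hβ => (hs ⟨β, hβ⟩).1,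
      t - s, mem_levelSet_of_forall_lt v hα.1 fun β hβ => (hs ⟨β, hβ⟩).2, by simp⟩

theorem isLevelFamily_smul (k : ℝ) (u : FuzzyNumber) :
    IsLevelFamily fun α => k • u.levelSet α where
  nonempty := (levelSet_nonempty u le_rfl).smul_set
  closed α _ := ((isCompact_levelSet u α).smul k).isClosed
  convex α _ := (convex_levelSet u α).smul k
  anti _ _ _ _ h := Set.smul_set_mono (levelSet_anti u h)
  bounded := ⟨_, (isCompact_levelSet u 0).smul k,
    fun α _ => Set.smul_set_mono (levelSet_subset_zero u α)⟩
  left := by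
    intro α hα t ht
    rcases eq_or_ne k 0 with rfl | hk
    · obtain ⟨β, hβ⟩ := Set.nonempty_Ioo.2 hα.1
      have h1 := ht β hβ
      simp only [Set.zero_smul_set (levelSet_nonempty u (hβ.2.le.trans hα.2))] at h1
      simpa only [Set.zero_smul_set (levelSet_nonempty u hα.2)] using h1
    · simp only [Set.mem_smul_set_iff_inv_smul_mem₀ hk] at ht ⊢
      exact mem_levelSet_of_forall_lt u hα.1 ht

theorem isLevelFamily_zero : IsLevelFamily fun _ => ({0} : Set ℝ) where
  nonempty := Set.singleton_nonempty 0
  closed _ _ := isClosed_singleton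
  convex _ _ := convex_singleton 0
  anti _ _ _ _ _ := subset_rfl
  bounded := ⟨{0}, isCompact_singleton, fun _ _ => subset_rfl⟩
  left α hα t ht := by
    obtain ⟨β, hβ⟩ := Set.nonempty_Ioo.2 hα.1
    exact ht β hβ

/-- The crisp number `0`. -/
instance : Zero FuzzyNumber := ⟨ofLevels _ isLevelFamily_zero⟩

/-- `[u + v]_α = [u]_α + [v]_α`. -/
instance : Add FuzzyNumber := ⟨fun u v => ofLevels _ (isLevelFamily_add u v)⟩

/-- `[k u]_α = k [u]_α`. -/
instance : SMul ℝ FuzzyNumber := ⟨fun k u => ofLevels _ (isLevelFamily_smul k u)⟩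

theorem levelSet_zero {α : ℝ} (hα : α ∈ Set.Ioc (0 : ℝ) 1) :
    (0 : FuzzyNumber).levelSet α = {0} := levelSet_ofLevels _ hα

theorem levelSet_add (u v : FuzzyNumber) {α : ℝ} (hα : α ∈ Set.Ioc (0 : ℝ) 1) :
    (u + v).levelSet α = u.levelSet α + v.levelSet α := levelSet_ofLevels _ hα

theorem levelSet_smul (k : ℝ) (u : FuzzyNumber) {α : ℝ} (hα : α ∈ Set.Ioc (0 : ℝ) 1) :
    (k • u).levelSet α = k • u.levelSet α := levelSet_ofLevels _ hα

/-- Finite sums of fuzzy numbers. -/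
instance : AddCommMonoid FuzzyNumber where
  add_assoc u v w := ext_levelSet fun α hα => by simp only [levelSet_add _ _ hα, add_assoc]
  zero_add u := ext_levelSet fun α hα => by simp [levelSet_add _ _ hα, levelSet_zero hα]
  add_zero u := ext_levelSet fun α hα => by simp [levelSet_add _ _ hα, levelSet_zero hα]
  add_comm u v := ext_levelSet fun α hα => by
    simp only [levelSet_add _ _ hα, add_comm (u.levelSet α)]
  nsmul := nsmulRec

/-- The distance `D(u,v) = sup_{α ∈ [0,1]} max {|u⁻_α - v⁻_α|, |u⁺_α - v⁺_α|}`. -/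
def D (u v : FuzzyNumber) : ℝ :=
  ⨆ α : Set.Icc (0 : ℝ) 1, max |u.lower α - v.lower α| |u.upper α - v.upper α|

theorem lower_mem (u : FuzzyNumber) {α : ℝ} (h : α ≤ 1) : u.lower α ∈ u.levelSet α :=
  (isCompact_levelSet u α).sInf_mem (levelSet_nonempty u h)

theorem upper_mem (u : FuzzyNumber) {α : ℝ} (h : α ≤ 1) : u.upper α ∈ u.levelSet α :=
  (isCompact_levelSet u α).sSup_mem (levelSet_nonempty u h)

theorem exists_bound (u : FuzzyNumber) :
    ∃ C, ∀ α ≤ (1 : ℝ), |u.lower α| ≤ C ∧ |u.upper α| ≤ C := by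
  obtain ⟨C, hC⟩ := (isCompact_levelSet u 0).isBounded.exists_norm_le
  exact ⟨C, fun α h => ⟨hC _ (levelSet_subset_zero u α (lower_mem u h)),
    hC _ (levelSet_subset_zero u α (upper_mem u h))⟩⟩

theorem bddAbove_D (u v : FuzzyNumber) : BddAbove (Set.range fun α : Set.Icc (0 : ℝ) 1 =>
    max |u.lower α - v.lower α| |u.upper α - v.upper α|) := by
  obtain ⟨C, hC⟩ := exists_bound u
  obtain ⟨C', hC'⟩ := exists_bound v
  refine ⟨C + C', ?_⟩
  rintro _ ⟨α, rfl⟩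
  exact max_le ((abs_sub _ _).trans (add_le_add (hC α α.2.2).1 (hC' α α.2.2).1))
    ((abs_sub _ _).trans (add_le_add (hC α α.2.2).2 (hC' α α.2.2).2))

instance : MetricSpace FuzzyNumber where
  dist := D
  dist_self u := by simp [D]
  dist_comm u v := by
    simp only [D, abs_sub_comm]
  dist_triangle u v w := by
    refine Real.iSup_le (fun α => ?_) (add_nonneg
      (Real.iSup_nonneg fun α => (abs_nonneg _).trans (le_max_left _ _))
      (Real.iSup_nonneg fun α => (abs_nonneg _).trans (le_max_left _ _)))
    have h1 := le_ciSup (bddAbove_D u v) α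
    have h2 := le_ciSup (bddAbove_D v w) α
    refine max_le ?_ ?_
    · exact (abs_sub_le _ (v.lower α) _).trans (add_le_add
        ((le_max_left _ _).trans h1) ((le_max_left _ _).trans h2))
    · exact (abs_sub_le _ (v.upper α) _).trans (add_le_add
        ((le_max_right _ _).trans h1) ((le_max_right _ _).trans h2))
  eq_of_dist_eq_zero := by
    intro u v h
    change D u v = 0 at h
    refine ext_levelSet fun α hα => ?_
    have h1 := le_ciSup (bddAbove_D u v) ⟨α, hα.1.le, hα.2⟩
    have h2 : max |u.lower α - v.lower α| |u.upper α - v.upper α| ≤ 0 := h1.trans h.le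
    have hl := abs_nonpos_iff.1 ((le_max_left _ _).trans h2)
    have hu := abs_nonpos_iff.1 ((le_max_right _ _).trans h2)
    rw [levelSet_eq_Icc u hα.2, levelSet_eq_Icc v hα.2, sub_eq_zero.1 hl, sub_eq_zero.1 hu]

end FuzzyNumber

/-- `f ∈ C_{2π}^{(F)}(ℝ²)`: continuous with respect to `D`, and `2π`-periodic in each variable. -/
structure IsFuzzyC2Pi (f : ℝ × ℝ → FuzzyNumber) : Prop where
  continuous : Continuous f
  periodic : ∀ (x y : ℝ) (k : ℤ),
    f (x + 2 * k * Real.pi, y) = f (x, y) ∧ f (x, y + 2 * k * Real.pi) = f (x, y)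

/-- `D*(f,g) = sup_{(x,y) ∈ ℝ²} D(f(x,y), g(x,y))`. -/
def Dstar (f g : ℝ × ℝ → FuzzyNumber) : ℝ := ⨆ z : ℝ × ℝ, FuzzyNumber.D (f z) (g z)

/-- On `C_{2π}^{(F)}(ℝ²)` the supremum defining `D*` is finite. -/
theorem bddAbove_Dstar {f g : ℝ × ℝ → FuzzyNumber} (hf : IsFuzzyC2Pi f) (hg : IsFuzzyC2Pi g) :
    BddAbove (Set.range fun z : ℝ × ℝ => FuzzyNumber.D (f z) (g z)) := by
  have hK : IsCompact (Set.Icc (0 : ℝ) (2 * Real.pi) ×ˢ Set.Icc (0 : ℝ) (2 * Real.pi)) :=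
    isCompact_Icc.prod isCompact_Icc
  obtain ⟨C, hC⟩ := (hK.image (hf.continuous.dist hg.continuous)).bddAbove
  refine ⟨C, ?_⟩
  have hred : ∀ x : ℝ, ∃ k : ℤ, x + 2 * k * Real.pi ∈ Set.Icc (0 : ℝ) (2 * Real.pi) := by
    intro x
    obtain ⟨k, hk, -⟩ := existsUnique_add_zsmul_mem_Ico Real.two_pi_pos x 0
    refine ⟨k, ?_⟩
    have h1 : x + 2 * k * Real.pi = x + k • (2 * Real.pi) := by
      rw [zsmul_eq_mul]
      ring
    rw [h1]
    simpa using Set.Ico_subset_Icc_self hk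
  rintro _ ⟨⟨x, y⟩, rfl⟩
  obtain ⟨j, hj⟩ := hred x
  obtain ⟨k, hk⟩ := hred y
  have h := hC ⟨(x + 2 * j * Real.pi, y + 2 * k * Real.pi), ⟨hj, hk⟩, rfl⟩
  simp only [(hf.periodic _ _ _).1, (hf.periodic _ _ _).2, (hg.periodic _ _ _).1,
    (hg.periodic _ _ _).2] at h
  exact h

/-- The fuzzy Riemann sum `∑_J |J| g(ξ_J)` of `g` over a tagged partition of a rectangle. -/
def fuzzyRiemannSum {I : BoxIntegral.Box (Fin 2)} (g : ℝ × ℝ → FuzzyNumber)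
    (P : BoxIntegral.TaggedPrepartition I) : FuzzyNumber :=
  ∑ J ∈ P.boxes, ((J.upper 0 - J.lower 0) * (J.upper 1 - J.lower 1)) •
    g (P.tag J 0, P.tag J 1)

/-- `w` is the fuzzy Riemann integral of `g` over the rectangle `I`: the Riemann sums over
partitions of `I` into rectangles `J`, with tags in the closed rectangles, tend to `w` in the
metric `D` as the mesh tends to `0`. -/
def HasFuzzyRiemannIntegral (I : BoxIntegral.Box (Fin 2)) (g : ℝ × ℝ → FuzzyNumber)
    (w : FuzzyNumber) : Prop :=
  ∀ ε > (0 : ℝ), ∃ δ > (0 : ℝ), ∀ P : BoxIntegral.TaggedPrepartition I,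
    P.IsPartition → P.IsHenstock → (∀ J ∈ P, ∀ i, J.upper i - J.lower i < δ) →
      FuzzyNumber.D (fuzzyRiemannSum g P) w < ε

open Classical in
/-- The fuzzy Riemann integral of `g` over the rectangle `I` (`0` if there is none). -/
def fuzzyRiemannIntegral (I : BoxIntegral.Box (Fin 2)) (g : ℝ × ℝ → FuzzyNumber) :
    FuzzyNumber :=
  if h : ∃ w, HasFuzzyRiemannIntegral I g w then h.choose else 0

/-- The square `[-π,π] × [-π,π]`. -/
def piSquare : BoxIntegral.Box (Fin 2) where
  lower := fun _ => -Real.pi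
  upper := fun _ => Real.pi
  lower_lt_upper := fun _ => neg_lt_self Real.pi_pos

open Classical in
/-- The Fejér kernel `φ_m`. -/
def fejerKernel (m : ℕ) (x : ℝ) : ℝ :=
  if ∃ k : ℤ, x = 2 * k * Real.pi then m + 1
  else Real.sin ((m + 1) * x / 2) ^ 2 / ((m + 1) * Real.sin (x / 2) ^ 2)

/-- The integrand `(u,v) ↦ φ_m(u) φ_n(v) f(x-u,y-v)`. -/
def fejerIntegrand (m n : ℕ) (f : ℝ × ℝ → FuzzyNumber) (z : ℝ × ℝ) (w : ℝ × ℝ) :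
    FuzzyNumber :=
  (fejerKernel m w.1 * fejerKernel n w.2) • f (z.1 - w.1, z.2 - w.2)

/-- The double fuzzy Fejér operator `F_{mn}(f; x, y)`. -/
def fuzzyFejer (m n : ℕ) (f : ℝ × ℝ → FuzzyNumber) (z : ℝ × ℝ) : FuzzyNumber :=
  (1 / (4 * Real.pi ^ 2)) • fuzzyRiemannIntegral piSquare (fejerIntegrand m n f z)

/-- `(1/π²) ∫_{-π}^{π} ∫_{-π}^{π} h(x,y) p(jx) q(ky) dx dy`. With `p, q` among `cos, sin` these are
the double Fourier coefficients `a_{jk}` (`cos, cos`), `b_{jk}` (`cos, sin`), `c_{jk}` (`sin, cos`)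
and `d_{jk}` (`sin, sin`) of `h`. -/
def fourierCoeff₂ (p q : ℝ → ℝ) (h : ℝ × ℝ → ℝ) (j k : ℕ) : ℝ :=
  1 / Real.pi ^ 2 * ∫ y in (-Real.pi)..Real.pi, ∫ x in (-Real.pi)..Real.pi,
    h (x, y) * p (j * x) * q (k * y)

/-- The `(j,k)` term of the double Fourier series of `h` at `z = (x,y)`. -/
def fourierTerm₂ (h : ℝ × ℝ → ℝ) (z : ℝ × ℝ) (j k : ℕ) : ℝ :=
  let a := fourierCoeff₂ Real.cos Real.cos h j k
  let b := fourierCoeff₂ Real.cos Real.sin h j k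
  let c := fourierCoeff₂ Real.sin Real.cos h j k
  let d := fourierCoeff₂ Real.sin Real.sin h j k
  if j = 0 ∧ k = 0 then a / 4
  else if k = 0 then 1 / 2 * (a * Real.cos (j * z.1) + c * Real.sin (j * z.1))
  else if j = 0 then 1 / 2 * (a * Real.cos (k * z.2) + b * Real.sin (k * z.2))
  else a * Real.cos (j * z.1) * Real.cos (k * z.2) + b * Real.cos (j * z.1) * Real.sin (k * z.2)
    + c * Real.sin (j * z.1) * Real.cos (k * z.2) + d * Real.sin (j * z.1) * Real.sin (k * z.2)

/-- The Cesàro mean `σ_{mn} = (1/((m+1)(n+1))) ∑_{j ≤ m} ∑_{k ≤ n} t_{jk}` of a double series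
`∑ u_{jk}` with partial sums `t_{jk}`. -/
def cesaroMean₂ (u : ℕ → ℕ → ℝ) (m n : ℕ) : ℝ :=
  1 / ((m + 1) * (n + 1)) * ∑ j ∈ Finset.range (m + 1), ∑ k ∈ Finset.range (n + 1),
    ∑ p ∈ Finset.range (j + 1), ∑ q ∈ Finset.range (k + 1), u p q

end

noncomputable section

/-! ### Endpoint functions and endpoint functionals -/

namespace FuzzyNumber

/-! Fuzzy numbers have no subtraction, so everything is tested on the endpoint functionals `e`
(`IsEndpoint`): `u ↦ u⁻_α` and `u ↦ u⁺_α`. They are additive, homogeneous for nonnegative scalars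
and 1-Lipschitz, and together they determine `D`. Since the Fejér kernels are nonnegative, `e`
passes through Riemann sums and through the operator. The fuzzy statement thus becomes a family of
real ones, with estimates that must not depend on `e`.

Integral: the endpointwise Lebesgue integrals are the endpoints of a fuzzy number, because
monotonicity and one-sided continuity in `α` survive integration (dominated convergence). Uniform
continuity of the integrand brings the Riemann sums close to it simultaneously for all `e`.

Cesàro means: the Fejér kernel is the Cesàro mean of the Dirichlet kernels. Periodicity moves the
translation onto the kernel, and the addition formula for the cosine produces the Fourier terms.

Convergence: a Korovkin argument. The mean is a positive linear functional that fixes constants, `f`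
oscillates by at most `ε + C(1 - cos u) + C(1 - cos v)`, and `φ_m(u)(1 - cos u) ≤ 2/(m+1)`. -/

theorem lower_le_of_mem (u : FuzzyNumber) {α t : ℝ} (h : t ∈ u.levelSet α) : u.lower α ≤ t :=
  csInf_le (isCompact_levelSet u α).bddBelow h

theorem le_upper_of_mem (u : FuzzyNumber) {α t : ℝ} (h : t ∈ u.levelSet α) : t ≤ u.upper α :=
  le_csSup (isCompact_levelSet u α).bddAbove h

theorem lower_mono (u : FuzzyNumber) {α β : ℝ} (h : α ≤ β) (hβ : β ≤ 1) :
    u.lower α ≤ u.lower β :=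
  lower_le_of_mem u (levelSet_anti u h (lower_mem u hβ))

theorem upper_anti (u : FuzzyNumber) {α β : ℝ} (h : α ≤ β) (hβ : β ≤ 1) :
    u.upper β ≤ u.upper α :=
  le_upper_of_mem u (levelSet_anti u h (upper_mem u hβ))

theorem lower_le_upper (u : FuzzyNumber) {α : ℝ} (h : α ≤ 1) : u.lower α ≤ u.upper α :=
  lower_le_of_mem u (upper_mem u h)

/-- A superlevel set `[u]_α` is the intersection of the `[u]_β` with `β < α`. If the left endpoints
stayed at or below some `a < u⁻_α`, then `a` would lie in all of these and hence in `[u]_α`. -/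
theorem tendsto_lower_left (u : FuzzyNumber) {α : ℝ} (hα : α ∈ Set.Ioc (0 : ℝ) 1) :
    Tendsto u.lower (𝓝[<] α) (𝓝 (u.lower α)) := by
  rw [tendsto_order]
  constructor
  · intro a ha
    by_contra hcon
    refine absurd (lower_le_of_mem u (mem_levelSet_of_forall_lt u hα.1 (t := a) ?_)) (not_le.2 ha)
    intro β hβ
    have hβ1 : β ≤ 1 := hβ.2.le.trans hα.2
    rw [levelSet_eq_Icc u hβ1]
    constructor
    · by_contra! hlt
      refine hcon ?_
      filter_upwards [Ioo_mem_nhdsLT hβ.2] with γ hγ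
      exact hlt.trans_le (lower_mono u hγ.1.le (hγ.2.le.trans hα.2))
    · exact (ha.le.trans (lower_le_upper u hα.2)).trans (upper_anti u hβ.2.le hα.2)
  · intro a ha
    filter_upwards [self_mem_nhdsWithin] with γ hγ
    exact (lower_mono u (le_of_lt hγ) hα.2).trans_lt ha

theorem tendsto_upper_left (u : FuzzyNumber) {α : ℝ} (hα : α ∈ Set.Ioc (0 : ℝ) 1) :
    Tendsto u.upper (𝓝[<] α) (𝓝 (u.upper α)) := by
  rw [tendsto_order]
  constructor
  · intro a ha
    filter_upwards [self_mem_nhdsWithin] with γ hγ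
    exact ha.trans_le (upper_anti u (le_of_lt hγ) hα.2)
  · intro a ha
    by_contra hcon
    refine absurd (le_upper_of_mem u (mem_levelSet_of_forall_lt u hα.1 (t := a) ?_)) (not_le.2 ha)
    intro β hβ
    have hβ1 : β ≤ 1 := hβ.2.le.trans hα.2
    rw [levelSet_eq_Icc u hβ1]
    constructor
    · exact (lower_mono u hβ.2.le hα.2).trans ((lower_le_upper u hα.2).trans ha.le)
    · by_contra! hlt
      refine hcon ?_
      filter_upwards [Ioo_mem_nhdsLT hβ.2] with γ hγ
      exact (upper_anti u hγ.1.le (hγ.2.le.trans hα.2)).trans_lt hlt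

theorem levelSet_nonpos (u : FuzzyNumber) {α : ℝ} (h : α ≤ 0) :
    u.levelSet α = closure {t | 0 < u.toFun t} := by
  simp [levelSet, not_lt.2 h]

/-- `[u]_0` is the closure of the positivity set, so arbitrarily close to `u⁻_0` there is `t` with
`u(t) > 0`, and this `t` belongs to `[u]_γ` for every `0 < γ ≤ u(t)`. -/
theorem tendsto_lower_zero (u : FuzzyNumber) : Tendsto u.lower (𝓝[>] 0) (𝓝 (u.lower 0)) := by
  rw [tendsto_order]
  constructor
  · intro a ha
    filter_upwards [Ioo_mem_nhdsGT one_pos] with γ hγ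
    exact ha.trans_le (lower_mono u hγ.1.le hγ.2.le)
  · intro a ha
    have h0 := lower_mem u zero_le_one
    rw [levelSet_nonpos u le_rfl] at h0
    obtain ⟨t, hta, ht⟩ := mem_closure_iff_nhds.1 h0 _ (Iio_mem_nhds ha)
    filter_upwards [Ioo_mem_nhdsGT (show (0 : ℝ) < u.toFun t from ht)] with γ hγ
    exact (lower_le_of_mem u ((mem_levelSet u hγ.1).2 hγ.2.le)).trans_lt hta

theorem tendsto_upper_zero (u : FuzzyNumber) : Tendsto u.upper (𝓝[>] 0) (𝓝 (u.upper 0)) := by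
  rw [tendsto_order]
  constructor
  · intro a ha
    have h0 := upper_mem u zero_le_one
    rw [levelSet_nonpos u le_rfl] at h0
    obtain ⟨t, hta, ht⟩ := mem_closure_iff_nhds.1 h0 _ (Ioi_mem_nhds ha)
    filter_upwards [Ioo_mem_nhdsGT (show (0 : ℝ) < u.toFun t from ht)] with γ hγ
    exact lt_of_lt_of_le hta (le_upper_of_mem u ((mem_levelSet u hγ.1).2 hγ.2.le))
  · intro a ha
    filter_upwards [Ioo_mem_nhdsGT one_pos] with γ hγ
    exact (upper_anti u hγ.1.le hγ.2.le).trans_lt ha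

/-- Two functions that agree on `(0,1]` and are right continuous at `0` agree on `[0,1]`. -/
theorem eq_of_eq_on_Ioc {p q : ℝ → ℝ} (hp : Tendsto p (𝓝[>] 0) (𝓝 (p 0)))
    (hq : Tendsto q (𝓝[>] 0) (𝓝 (q 0))) (h : ∀ α ∈ Set.Ioc (0 : ℝ) 1, p α = q α)
    {α : ℝ} (hα : α ∈ Set.Icc (0 : ℝ) 1) : p α = q α := by
  rcases hα.1.eq_or_lt with rfl | h0
  · refine tendsto_nhds_unique hp (hq.congr' ?_)
    filter_upwards [Ioo_mem_nhdsGT one_pos] with γ hγ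
    exact (h γ ⟨hγ.1, hγ.2.le⟩).symm
  · exact h α ⟨h0, hα.2⟩

/-- The sum is built from its levels in `(0,1]`; level `0` is recovered by right continuity. -/
theorem lower_add (u v : FuzzyNumber) {α : ℝ} (hα : α ∈ Set.Icc (0 : ℝ) 1) :
    (u + v).lower α = u.lower α + v.lower α := by
  refine eq_of_eq_on_Ioc (q := fun α => u.lower α + v.lower α) (tendsto_lower_zero _)
    ((tendsto_lower_zero u).add (tendsto_lower_zero v)) (fun α hα => ?_) hα
  rw [lower, levelSet_add _ _ hα]
  exact csInf_add (levelSet_nonempty u hα.2) (isCompact_levelSet u α).bddBelow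
    (levelSet_nonempty v hα.2) (isCompact_levelSet v α).bddBelow

theorem upper_add (u v : FuzzyNumber) {α : ℝ} (hα : α ∈ Set.Icc (0 : ℝ) 1) :
    (u + v).upper α = u.upper α + v.upper α := by
  refine eq_of_eq_on_Ioc (q := fun α => u.upper α + v.upper α) (tendsto_upper_zero _)
    ((tendsto_upper_zero u).add (tendsto_upper_zero v)) (fun α hα => ?_) hα
  rw [upper, levelSet_add _ _ hα]
  exact csSup_add (levelSet_nonempty u hα.2) (isCompact_levelSet u α).bddAbove
    (levelSet_nonempty v hα.2) (isCompact_levelSet v α).bddAbove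

/-- The sign of `k` matters: a negative scalar exchanges the two endpoints. -/
theorem lower_smul {k : ℝ} (hk : 0 ≤ k) (u : FuzzyNumber) {α : ℝ} (hα : α ∈ Set.Icc (0 : ℝ) 1) :
    (k • u).lower α = k * u.lower α := by
  refine eq_of_eq_on_Ioc (q := fun α => k * u.lower α) (tendsto_lower_zero _)
    ((tendsto_lower_zero u).const_mul k) (fun α hα => ?_) hα
  rw [lower, levelSet_smul _ _ hα]
  exact Real.sInf_smul_of_nonneg hk _

theorem upper_smul {k : ℝ} (hk : 0 ≤ k) (u : FuzzyNumber) {α : ℝ} (hα : α ∈ Set.Icc (0 : ℝ) 1) :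
    (k • u).upper α = k * u.upper α := by
  refine eq_of_eq_on_Ioc (q := fun α => k * u.upper α) (tendsto_upper_zero _)
    ((tendsto_upper_zero u).const_mul k) (fun α hα => ?_) hα
  rw [upper, levelSet_smul _ _ hα]
  exact Real.sSup_smul_of_nonneg hk _

theorem dist_def (u v : FuzzyNumber) : dist u v = D u v := rfl

theorem abs_lower_sub_le (u v : FuzzyNumber) {α : ℝ} (hα : α ∈ Set.Icc (0 : ℝ) 1) :
    |u.lower α - v.lower α| ≤ dist u v :=
  (le_max_left _ _).trans (le_ciSup (bddAbove_D u v) ⟨α, hα⟩)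

theorem abs_upper_sub_le (u v : FuzzyNumber) {α : ℝ} (hα : α ∈ Set.Icc (0 : ℝ) 1) :
    |u.upper α - v.upper α| ≤ dist u v :=
  (le_max_right _ _).trans (le_ciSup (bddAbove_D u v) ⟨α, hα⟩)

/-- `e` is one of the functionals `u ↦ u⁻_α`, `u ↦ u⁺_α`, for some `α ∈ [0,1]`. -/
def IsEndpoint (e : FuzzyNumber → ℝ) : Prop :=
  ∃ α ∈ Set.Icc (0 : ℝ) 1, e = (fun u => u.lower α) ∨ e = fun u => u.upper α

theorem isEndpoint_lower {α : ℝ} (hα : α ∈ Set.Icc (0 : ℝ) 1) :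
    IsEndpoint fun u => u.lower α := ⟨α, hα, Or.inl rfl⟩

theorem isEndpoint_upper {α : ℝ} (hα : α ∈ Set.Icc (0 : ℝ) 1) :
    IsEndpoint fun u => u.upper α := ⟨α, hα, Or.inr rfl⟩

namespace IsEndpoint

variable {e : FuzzyNumber → ℝ}

theorem map_add (he : IsEndpoint e) (u v : FuzzyNumber) : e (u + v) = e u + e v := by
  obtain ⟨α, hα, rfl | rfl⟩ := he
  · exact lower_add u v hα
  · exact upper_add u v hα

theorem map_smul (he : IsEndpoint e) {k : ℝ} (hk : 0 ≤ k) (u : FuzzyNumber) :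
    e (k • u) = k * e u := by
  obtain ⟨α, hα, rfl | rfl⟩ := he
  · exact lower_smul hk u hα
  · exact upper_smul hk u hα

theorem map_zero (he : IsEndpoint e) : e 0 = 0 := by
  have := he.map_add 0 0
  rw [add_zero] at this
  linarith

theorem map_sum (he : IsEndpoint e) {ι : Type*} (s : Finset ι) (g : ι → FuzzyNumber) :
    e (∑ i ∈ s, g i) = ∑ i ∈ s, e (g i) := by
  classical
  induction s using Finset.induction_on with
  | empty => simpa using he.map_zero
  | insert i s hi ih => rw [Finset.sum_insert hi, Finset.sum_insert hi, he.map_add, ih]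

theorem abs_sub_le (he : IsEndpoint e) (u v : FuzzyNumber) : |e u - e v| ≤ dist u v := by
  obtain ⟨α, hα, rfl | rfl⟩ := he
  · exact abs_lower_sub_le u v hα
  · exact abs_upper_sub_le u v hα

theorem abs_le (he : IsEndpoint e) (u : FuzzyNumber) : |e u| ≤ dist u 0 := by
  simpa [he.map_zero] using he.abs_sub_le u 0

theorem continuous (he : IsEndpoint e) : Continuous e :=
  LipschitzWith.continuous (K := 1) (LipschitzWith.of_dist_le_mul fun u v => by
    simpa [Real.dist_eq] using he.abs_sub_le u v)

end IsEndpoint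

/-- Converse to `IsEndpoint.abs_sub_le`: estimates in `D` are obtained by bounding every endpoint
with one constant. -/
theorem dist_le_of_endpoints {u v : FuzzyNumber} {r : ℝ}
    (h : ∀ e, IsEndpoint e → |e u - e v| ≤ r) : dist u v ≤ r := by
  have : Nonempty (Set.Icc (0 : ℝ) 1) := ⟨⟨0, by simp⟩⟩
  exact ciSup_le fun α => max_le (h _ (isEndpoint_lower α.2)) (h _ (isEndpoint_upper α.2))

theorem dist_smul_smul_le {k l : ℝ} (hk : 0 ≤ k) (hl : 0 ≤ l) (u v : FuzzyNumber) :
    dist (k • u) (l • v) ≤ k * dist u v + |k - l| * dist v 0 := by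
  refine dist_le_of_endpoints fun e he => ?_
  rw [he.map_smul hk, he.map_smul hl,
    show k * e u - l * e v = k * (e u - e v) + (k - l) * e v by ring]
  refine (abs_add_le _ _).trans (add_le_add ?_ ?_)
  · rw [abs_mul, abs_of_nonneg hk]
    exact mul_le_mul_of_nonneg_left (he.abs_sub_le u v) hk
  · rw [abs_mul]
    exact mul_le_mul_of_nonneg_left (he.abs_le v) (abs_nonneg _)

theorem continuous_smul_of_nonneg {X : Type*} [TopologicalSpace X] {k : X → ℝ}
    {g : X → FuzzyNumber} (hk : Continuous k) (hg : Continuous g) (h0 : ∀ x, 0 ≤ k x) :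
    Continuous fun x => k x • g x := by
  refine continuous_iff_continuousAt.2 fun x => tendsto_iff_dist_tendsto_zero.2 ?_
  have h1 : Tendsto (fun y => k y * dist (g y) (g x) + |k y - k x| * dist (g x) 0) (𝓝 x)
      (𝓝 (k x * dist (g x) (g x) + |k x - k x| * dist (g x) 0)) := by
    apply Continuous.tendsto
    fun_prop
  simp only [dist_self, mul_zero, sub_self, abs_zero, zero_mul, add_zero] at h1
  exact squeeze_zero (fun y => dist_nonneg)
    (fun y => dist_smul_smul_le (h0 y) (h0 x) (g y) (g x)) h1

/-- A fuzzy number with prescribed endpoint functions. -/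
theorem exists_of_endpoints {L U : ℝ → ℝ} (hL : MonotoneOn L (Set.Icc 0 1))
    (hU : AntitoneOn U (Set.Icc 0 1)) (hLU : L 1 ≤ U 1)
    (hLl : ∀ α ∈ Set.Ioc (0 : ℝ) 1, Tendsto L (𝓝[<] α) (𝓝 (L α)))
    (hUl : ∀ α ∈ Set.Ioc (0 : ℝ) 1, Tendsto U (𝓝[<] α) (𝓝 (U α)))
    (hL0 : Tendsto L (𝓝[>] 0) (𝓝 (L 0))) (hU0 : Tendsto U (𝓝[>] 0) (𝓝 (U 0))) :
    ∃ w : FuzzyNumber, ∀ α ∈ Set.Icc (0 : ℝ) 1, w.lower α = L α ∧ w.upper α = U α := by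
  have hsub : Set.Ioc (0 : ℝ) 1 ⊆ Set.Icc 0 1 := Set.Ioc_subset_Icc_self
  have h01 : (0 : ℝ) ∈ Set.Icc (0 : ℝ) 1 := by simp
  have h11 : (1 : ℝ) ∈ Set.Icc (0 : ℝ) 1 := by simp
  have hA : IsLevelFamily fun α => Set.Icc (L α) (U α) :=
    { nonempty := Set.nonempty_Icc.2 hLU
      closed := fun _ _ => isClosed_Icc
      convex := fun _ _ => convex_Icc _ _
      anti := fun α hα β hβ h =>
        Set.Icc_subset_Icc (hL (hsub hα) (hsub hβ) h) (hU (hsub hα) (hsub hβ) h)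
      left := fun α hα t ht => by
        have hev : ∀ᶠ β in 𝓝[<] α, t ∈ Set.Icc (L β) (U β) := by
          filter_upwards [Ioo_mem_nhdsLT hα.1] with β hβ using ht β hβ
        exact ⟨le_of_tendsto (hLl α hα) (hev.mono fun _ h => h.1),
          ge_of_tendsto (hUl α hα) (hev.mono fun _ h => h.2)⟩
      bounded := ⟨Set.Icc (L 0) (U 0), isCompact_Icc, fun α hα =>
        Set.Icc_subset_Icc (hL h01 (hsub hα) hα.1.le) (hU h01 (hsub hα) hα.1.le)⟩ }
  -- Every interval contains `[L 1, U 1]`, so none is empty and its infimum and supremum are the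
  -- prescribed endpoints.
  have hle : ∀ α ∈ Set.Ioc (0 : ℝ) 1, L α ≤ U α := fun α hα =>
    (hL (hsub hα) h11 hα.2).trans (hLU.trans (hU (hsub hα) h11 hα.2))
  refine ⟨ofLevels _ hA, fun α hα => ⟨?_, ?_⟩⟩
  · refine eq_of_eq_on_Ioc (tendsto_lower_zero _) hL0 (fun β hβ => ?_) hα
    rw [lower, levelSet_ofLevels hA hβ, csInf_Icc (hle β hβ)]
  · refine eq_of_eq_on_Ioc (tendsto_upper_zero _) hU0 (fun β hβ => ?_) hα
    rw [upper, levelSet_ofLevels hA hβ, csSup_Icc (hle β hβ)]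

end FuzzyNumber

open MeasureTheory in
/-- A bounded continuous family of fuzzy numbers has a levelwise integral. -/
theorem FuzzyNumber.exists_levelwise_integral {X : Type*} [TopologicalSpace X] [MeasurableSpace X]
    [OpensMeasurableSpace X] (μ : Measure X) [IsFiniteMeasure μ] {g : X → FuzzyNumber}
    (hg : Continuous g) {C : ℝ} (hC : ∀ᵐ x ∂μ, dist (g x) 0 ≤ C) :
    ∃ w : FuzzyNumber, ∀ e, IsEndpoint e → e w = ∫ x, e (g x) ∂μ := by
  have hmeas : ∀ e, IsEndpoint e → AEStronglyMeasurable (fun x => e (g x)) μ := fun e he =>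
    (he.continuous.comp hg).measurable.aestronglyMeasurable
  have hbd : ∀ e, IsEndpoint e → ∀ᵐ x ∂μ, ‖e (g x)‖ ≤ C := fun e he =>
    hC.mono fun x hx => (he.abs_le (g x)).trans hx
  have hint : ∀ e, IsEndpoint e → Integrable (fun x => e (g x)) μ := fun e he =>
    (integrable_const C).mono' (hmeas e he) (hbd e he)
  -- One dominated convergence argument, with the constant `C` as majorant, serves the left limits
  -- and the limit at `0` for both endpoints.
  have hlim : ∀ (e : ℝ → FuzzyNumber → ℝ) (l : Filter ℝ) [l.IsCountablyGenerated] (α : ℝ),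
      (∀ᶠ β in l, IsEndpoint (e β)) →
      (∀ u, Tendsto (fun β => e β u) l (𝓝 (e α u))) →
      Tendsto (fun β => ∫ x, e β (g x) ∂μ) l (𝓝 (∫ x, e α (g x) ∂μ)) := by
    intro e l _ α he h
    exact tendsto_integral_filter_of_dominated_convergence (fun _ => C)
      (he.mono fun β hβ => hmeas _ hβ) (he.mono fun β hβ => hbd _ hβ) (integrable_const C)
      (Eventually.of_forall fun x => h (g x))
  have hev : ∀ α ∈ Set.Ioc (0 : ℝ) 1, ∀ᶠ β in 𝓝[<] α, β ∈ Set.Icc (0 : ℝ) 1 := fun α hα => by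
    filter_upwards [Ioo_mem_nhdsLT hα.1] with β hβ using ⟨hβ.1.le, hβ.2.le.trans hα.2⟩
  have hev0 : ∀ᶠ β in 𝓝[>] (0 : ℝ), β ∈ Set.Icc (0 : ℝ) 1 := by
    filter_upwards [Ioo_mem_nhdsGT (zero_lt_one (α := ℝ))] with β hβ using ⟨hβ.1.le, hβ.2.le⟩
  obtain ⟨w, hw⟩ := exists_of_endpoints (L := fun α => ∫ x, (g x).lower α ∂μ)
    (U := fun α => ∫ x, (g x).upper α ∂μ)
    (fun α hα β hβ h => integral_mono (hint _ (isEndpoint_lower hα)) (hint _ (isEndpoint_lower hβ))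
      fun x => lower_mono _ h hβ.2)
    (fun α hα β hβ h => integral_mono (hint _ (isEndpoint_upper hβ)) (hint _ (isEndpoint_upper hα))
      fun x => upper_anti _ h hβ.2)
    (integral_mono (hint _ (isEndpoint_lower (by simp))) (hint _ (isEndpoint_upper (by simp)))
      fun x => lower_le_upper _ le_rfl)
    (fun α hα => hlim (fun β u => u.lower β) _ α ((hev α hα).mono fun _ h => isEndpoint_lower h)
      fun u => tendsto_lower_left u hα)
    (fun α hα => hlim (fun β u => u.upper β) _ α ((hev α hα).mono fun _ h => isEndpoint_upper h)
      fun u => tendsto_upper_left u hα)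
    (hlim (fun β u => u.lower β) _ 0 (hev0.mono fun _ h => isEndpoint_lower h) tendsto_lower_zero)
    (hlim (fun β u => u.upper β) _ 0 (hev0.mono fun _ h => isEndpoint_upper h) tendsto_upper_zero)
  refine ⟨w, ?_⟩
  rintro e ⟨α, hα, rfl | rfl⟩
  · exact (hw α hα).1
  · exact (hw α hα).2

/-! ### Riemann sums and the levelwise integral -/

/-- A box in `Fin 2 → ℝ` as a subset of `ℝ × ℝ`. -/
def planeRect (J : BoxIntegral.Box (Fin 2)) : Set (ℝ × ℝ) :=
  Set.Ioc (J.lower 0) (J.upper 0) ×ˢ Set.Ioc (J.lower 1) (J.upper 1)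

/-- The closed rectangle of a box in `Fin 2 → ℝ`, as a subset of `ℝ × ℝ`. -/
def planeRectClosed (J : BoxIntegral.Box (Fin 2)) : Set (ℝ × ℝ) :=
  Set.Icc (J.lower 0) (J.upper 0) ×ˢ Set.Icc (J.lower 1) (J.upper 1)

/-- Boxes are half-open, so the rectangles of a partition are genuinely disjoint and additivity of
measure and integral applies exactly. -/
theorem mem_planeRect (J : BoxIntegral.Box (Fin 2)) (z : ℝ × ℝ) :
    z ∈ planeRect J ↔ ![z.1, z.2] ∈ J := by
  simp [planeRect, BoxIntegral.Box.mem_def, Fin.forall_fin_two]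

theorem planeRect_subset_closed (J : BoxIntegral.Box (Fin 2)) :
    planeRect J ⊆ planeRectClosed J :=
  Set.prod_mono Set.Ioc_subset_Icc_self Set.Ioc_subset_Icc_self

theorem isCompact_planeRectClosed (J : BoxIntegral.Box (Fin 2)) :
    IsCompact (planeRectClosed J) := isCompact_Icc.prod isCompact_Icc

theorem measurableSet_planeRect (J : BoxIntegral.Box (Fin 2)) : MeasurableSet (planeRect J) :=
  measurableSet_Ioc.prod measurableSet_Ioc

theorem volume_planeRect_lt_top (J : BoxIntegral.Box (Fin 2)) :
    MeasureTheory.volume (planeRect J) < ⊤ :=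
  (MeasureTheory.measure_mono (planeRect_subset_closed J)).trans_lt
    (isCompact_planeRectClosed J).measure_lt_top

theorem volume_real_planeRect (J : BoxIntegral.Box (Fin 2)) :
    MeasureTheory.volume.real (planeRect J) =
      (J.upper 0 - J.lower 0) * (J.upper 1 - J.lower 1) := by
  rw [planeRect, MeasureTheory.Measure.volume_eq_prod, MeasureTheory.measureReal_prod_prod,
    Real.volume_real_Ioc_of_le (J.lower_le_upper 0), Real.volume_real_Ioc_of_le (J.lower_le_upper 1)]

theorem Continuous.integrableOn_planeRect {h : ℝ × ℝ → ℝ} (hh : Continuous h)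
    (J : BoxIntegral.Box (Fin 2)) :
    MeasureTheory.IntegrableOn h (planeRect J) :=
  (hh.continuousOn.integrableOn_compact (isCompact_planeRectClosed J)).mono_set
    (planeRect_subset_closed J)

section RiemannSums

variable {I : BoxIntegral.Box (Fin 2)}

theorem iUnion_planeRect {P : BoxIntegral.TaggedPrepartition I} (hP : P.IsPartition) :
    ⋃ J ∈ P.boxes, planeRect J = planeRect I := by
  ext z
  simp only [Set.mem_iUnion, mem_planeRect, exists_prop]
  constructor
  · rintro ⟨J, hJ, hz⟩
    exact P.le_of_mem' J hJ hz
  · intro hz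
    obtain ⟨J, hJ, hz⟩ := hP _ hz
    exact ⟨J, hJ, hz⟩

theorem pairwise_disjoint_planeRect (P : BoxIntegral.TaggedPrepartition I) :
    (P.boxes : Set (BoxIntegral.Box (Fin 2))).Pairwise (Function.onFun Disjoint planeRect) := by
  intro J hJ J' hJ' hne
  refine Set.disjoint_left.2 fun z hz hz' => hne ?_
  rw [mem_planeRect] at hz hz'
  exact P.toPrepartition.eq_of_mem_of_mem hJ hJ' hz hz'

theorem sum_volume_planeRect {P : BoxIntegral.TaggedPrepartition I} (hP : P.IsPartition) :
    ∑ J ∈ P.boxes, MeasureTheory.volume.real (planeRect J) =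
      MeasureTheory.volume.real (planeRect I) := by
  rw [← iUnion_planeRect hP]
  exact (MeasureTheory.measureReal_biUnion_finset (pairwise_disjoint_planeRect P)
    (fun J _ => measurableSet_planeRect J) (fun J _ => (volume_planeRect_lt_top J).ne)).symm

theorem endpoint_fuzzyRiemannSum {e : FuzzyNumber → ℝ} (he : FuzzyNumber.IsEndpoint e)
    (g : ℝ × ℝ → FuzzyNumber) (P : BoxIntegral.TaggedPrepartition I) :
    e (fuzzyRiemannSum g P) = ∑ J ∈ P.boxes,
      MeasureTheory.volume.real (planeRect J) * e (g (P.tag J 0, P.tag J 1)) := by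
  rw [fuzzyRiemannSum, he.map_sum]
  refine Finset.sum_congr rfl fun J _ => ?_
  rw [volume_real_planeRect, he.map_smul]
  exact mul_nonneg (sub_nonneg.2 (J.lower_le_upper 0)) (sub_nonneg.2 (J.lower_le_upper 1))

open MeasureTheory in
-- On each rectangle the error is the integral of `e(g(tag)) - e(g(z))`, and `e` is 1-Lipschitz. The
-- bound does not involve `e`, so it passes to `D`.
theorem abs_endpoint_fuzzyRiemannSum_sub_integral_le {e : FuzzyNumber → ℝ}
    (he : FuzzyNumber.IsEndpoint e) {g : ℝ × ℝ → FuzzyNumber} (hg : Continuous g)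
    {P : BoxIntegral.TaggedPrepartition I} (hP : P.IsPartition) {ε : ℝ}
    (hε : ∀ J ∈ P, ∀ z ∈ planeRect J, dist (g (P.tag J 0, P.tag J 1)) (g z) ≤ ε) :
    |e (fuzzyRiemannSum g P) - ∫ z in planeRect I, e (g z)| ≤ ε * volume.real (planeRect I) := by
  have hc : Continuous fun z => e (g z) := he.continuous.comp hg
  -- The first rewriting also turns the volume on the right into that of the union; the second use
  -- of `iUnion_planeRect` undoes this.
  rw [← iUnion_planeRect hP, integral_biUnion_finset _ (fun J _ => measurableSet_planeRect J)
    (pairwise_disjoint_planeRect P) (fun J _ => hc.integrableOn_planeRect J),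
    iUnion_planeRect hP, endpoint_fuzzyRiemannSum he, ← Finset.sum_sub_distrib,
    ← sum_volume_planeRect hP, Finset.mul_sum]
  refine (Finset.abs_sum_le_sum_abs _ _).trans (Finset.sum_le_sum fun J hJ => ?_)
  have h1 : volume.real (planeRect J) * e (g (P.tag J 0, P.tag J 1)) =
      ∫ z in planeRect J, e (g (P.tag J 0, P.tag J 1)) := by
    rw [setIntegral_const, smul_eq_mul]
  rw [h1, ← integral_sub (continuous_const.integrableOn_planeRect J)
    (hc.integrableOn_planeRect J), ← Real.norm_eq_abs]
  exact norm_setIntegral_le_of_norm_le_const (volume_planeRect_lt_top J) fun z hz =>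
    (he.abs_sub_le _ _).trans (hε J hJ z hz)

open MeasureTheory in
/-- A continuous function is fuzzy Riemann integrable, and its integral is taken levelwise. -/
theorem exists_hasFuzzyRiemannIntegral (I : BoxIntegral.Box (Fin 2)) {g : ℝ × ℝ → FuzzyNumber}
    (hg : Continuous g) :
    ∃ w, HasFuzzyRiemannIntegral I g w ∧
      ∀ e, FuzzyNumber.IsEndpoint e → e w = ∫ z in planeRect I, e (g z) := by
  have hK := isCompact_planeRectClosed I
  obtain ⟨C, hC⟩ := (hK.image (hg.dist (continuous_const (y := (0 : FuzzyNumber))))).bddAbove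
  have : IsFiniteMeasure (volume.restrict (planeRect I)) :=
    isFiniteMeasure_restrict.2 (volume_planeRect_lt_top I).ne
  obtain ⟨w, hw⟩ := FuzzyNumber.exists_levelwise_integral (volume.restrict (planeRect I)) hg
    (C := C) (by
      filter_upwards [ae_restrict_mem (measurableSet_planeRect I)] with z hz
      exact hC ⟨z, planeRect_subset_closed I hz, rfl⟩)
  refine ⟨w, fun ε hε => ?_, hw⟩
  have hV : 0 ≤ volume.real (planeRect I) := measureReal_nonneg
  -- The `+ 1` avoids division by a possibly zero area, and the factor `2` makes the final
  -- inequality strict.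
  have hη : 0 < ε / (2 * (volume.real (planeRect I) + 1)) := by positivity
  obtain ⟨δ, hδ, hunif⟩ := Metric.uniformContinuousOn_iff.1
    (hK.uniformContinuousOn_of_continuous hg.continuousOn) _ hη
  refine ⟨δ, hδ, fun P hP hH hmesh => ?_⟩
  -- The Henstock condition puts the tag in the closed rectangle of `J`, so both points lie there
  -- and their sup-distance is below the mesh bound.
  have hclose : ∀ J ∈ P, ∀ z ∈ planeRect J, dist (g (P.tag J 0, P.tag J 1)) (g z) ≤
      ε / (2 * (volume.real (planeRect I) + 1)) := by
    intro J hJ z hz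
    have hle := BoxIntegral.Box.le_iff_bounds.1 (P.le_of_mem' J hJ)
    have ht := hH J hJ
    rw [BoxIntegral.Box.Icc_def] at ht
    have ht0 : P.tag J 0 ∈ Set.Icc (J.lower 0) (J.upper 0) := ⟨ht.1 0, ht.2 0⟩
    have ht1 : P.tag J 1 ∈ Set.Icc (J.lower 1) (J.upper 1) := ⟨ht.1 1, ht.2 1⟩
    have hz' := planeRect_subset_closed J hz
    have hsub : planeRectClosed J ⊆ planeRectClosed I :=
      Set.prod_mono (Set.Icc_subset_Icc (hle.1 0) (hle.2 0))
        (Set.Icc_subset_Icc (hle.1 1) (hle.2 1))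
    refine (hunif _ (hsub ⟨ht0, ht1⟩) _ (hsub hz') ?_).le
    rw [Prod.dist_eq]
    exact max_lt ((Real.dist_le_of_mem_Icc ht0 hz'.1).trans_lt (hmesh J hJ 0))
      ((Real.dist_le_of_mem_Icc ht1 hz'.2).trans_lt (hmesh J hJ 1))
  have hle : dist (fuzzyRiemannSum g P) w ≤
      ε / (2 * (volume.real (planeRect I) + 1)) * volume.real (planeRect I) :=
    FuzzyNumber.dist_le_of_endpoints fun e he => by
      rw [hw e he]
      exact abs_endpoint_fuzzyRiemannSum_sub_integral_le he hg hP hclose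
  refine hle.trans_lt ?_
  rw [div_mul_eq_mul_div, div_lt_iff₀ (by positivity)]
  nlinarith

/-- The definition would be vacuous if no fine tagged partition existed; subordinate homothetic
partitions supply one of arbitrarily small mesh. -/
theorem HasFuzzyRiemannIntegral.unique {g : ℝ × ℝ → FuzzyNumber} {w w' : FuzzyNumber}
    (h : HasFuzzyRiemannIntegral I g w) (h' : HasFuzzyRiemannIntegral I g w') : w = w' := by
  refine eq_of_forall_dist_le fun ε hε => ?_
  obtain ⟨δ, hδ, h1⟩ := h (ε / 2) (half_pos hε)
  obtain ⟨δ', hδ', h2⟩ := h' (ε / 2) (half_pos hε)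
  -- A box within distance `r` of its tag has sides at most `2r`, which is below `min δ δ'` for `r =
  -- min δ δ' / 3`.
  have hr : 0 < min δ δ' / 3 := by positivity
  obtain ⟨P, hP, hH, hS, -⟩ :=
    BoxIntegral.Box.exists_taggedPartition_isHenstock_isSubordinate_homothetic I
      fun _ => ⟨min δ δ' / 3, hr⟩
  have hmesh : ∀ J ∈ P, ∀ i, J.upper i - J.lower i < min δ δ' := by
    intro J hJ i
    have hu := Metric.mem_closedBall.1 (hS J hJ J.upper_mem_Icc)
    have hl := Metric.mem_closedBall.1 (hS J hJ J.lower_mem_Icc)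
    have hu' := (abs_le.1 ((Real.dist_eq _ _).symm.le.trans ((dist_le_pi_dist _ _ i).trans hu))).2
    have hl' := (abs_le.1 ((Real.dist_eq _ _).symm.le.trans ((dist_le_pi_dist _ _ i).trans hl))).1
    simp only at hu' hl'
    linarith
  have a1 := h1 P hP hH fun J hJ i => (hmesh J hJ i).trans_le (min_le_left _ _)
  have a2 := h2 P hP hH fun J hJ i => (hmesh J hJ i).trans_le (min_le_right _ _)
  rw [← FuzzyNumber.dist_def] at a1 a2
  rw [dist_comm] at a1
  linarith [dist_triangle w (fuzzyRiemannSum g P) w']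

theorem hasFuzzyRiemannIntegral_fuzzyRiemannIntegral {g : ℝ × ℝ → FuzzyNumber}
    (hg : Continuous g) : HasFuzzyRiemannIntegral I g (fuzzyRiemannIntegral I g) := by
  obtain ⟨w, hw, -⟩ := exists_hasFuzzyRiemannIntegral I hg
  have h : ∃ w, HasFuzzyRiemannIntegral I g w := ⟨w, hw⟩
  rw [fuzzyRiemannIntegral, dif_pos h]
  exact h.choose_spec

theorem endpoint_fuzzyRiemannIntegral {g : ℝ × ℝ → FuzzyNumber} (hg : Continuous g)
    {e : FuzzyNumber → ℝ} (he : FuzzyNumber.IsEndpoint e) :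
    e (fuzzyRiemannIntegral I g) = ∫ z in planeRect I, e (g z) := by
  obtain ⟨w, hw, hwe⟩ := exists_hasFuzzyRiemannIntegral I hg
  rw [(hasFuzzyRiemannIntegral_fuzzyRiemannIntegral hg).unique hw]
  exact hwe e he

end RiemannSums

/-! ### The Fejér kernel -/

theorem exists_int_eq_iff_sin_half_eq_zero (x : ℝ) :
    (∃ k : ℤ, x = 2 * k * Real.pi) ↔ Real.sin (x / 2) = 0 := by
  rw [Real.sin_eq_zero_iff]
  refine exists_congr fun k => ?_
  constructor <;> intro h <;> linarith

/-- The coefficients `1, 2, 2, …` of the Dirichlet kernel `1 + 2 ∑ cos (p x)`. -/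
def dirichletWeight (p : ℕ) : ℝ := if p = 0 then 1 else 2

/-- Telescoping: `2 cos(px) sin(x/2) = sin((p+1/2)x) - sin((p-1/2)x)`. -/
theorem dirichlet_sum_mul_sin_half (j : ℕ) (x : ℝ) :
    (∑ p ∈ Finset.range (j + 1), dirichletWeight p * Real.cos (p * x)) * Real.sin (x / 2) =
      Real.sin ((j + 1 / 2) * x) := by
  induction j with
  | zero =>
    simp only [dirichletWeight, zero_add, Finset.sum_range_one, if_true, Nat.cast_zero, zero_mul,
      Real.cos_zero, one_mul]
    ring_nf
  | succ j ih =>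
    rw [Finset.sum_range_succ, add_mul, ih]
    simp only [dirichletWeight, Nat.succ_ne_zero, if_false]
    have h1 : ((j : ℝ) + 1 / 2) * x = ((j + 1 : ℕ) : ℝ) * x - x / 2 := by push_cast; ring
    have h2 : (((j + 1 : ℕ) : ℝ) + 1 / 2) * x = ((j + 1 : ℕ) : ℝ) * x + x / 2 := by ring
    rw [h1, h2, Real.sin_sub, Real.sin_add]
    ring

theorem sum_sin_mul_sin_half (m : ℕ) (x : ℝ) :
    (∑ j ∈ Finset.range (m + 1), Real.sin (((j : ℝ) + 1 / 2) * x)) * Real.sin (x / 2) =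
      Real.sin ((m + 1) * x / 2) ^ 2 := by
  induction m with
  | zero =>
    simp only [zero_add, Finset.sum_range_one, Nat.cast_zero, one_mul]
    ring_nf
  | succ m ih =>
    rw [Finset.sum_range_succ, add_mul, ih]
    have h1 : (((m + 1 : ℕ) : ℝ) + 1 / 2) * x = 2 * ((m + 1) * x / 2) + x / 2 := by
      push_cast; ring
    have h2 : (((m + 1 : ℕ) : ℝ) + 1) * x / 2 = (m + 1) * x / 2 + x / 2 := by push_cast; ring
    rw [h1, h2, Real.sin_add, Real.sin_add, Real.sin_two_mul, Real.cos_two_mul]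
    have h3 := Real.sin_sq_add_cos_sq ((m + 1) * x / 2)
    have h4 := Real.sin_sq_add_cos_sq (x / 2)
    generalize Real.sin ((m + 1) * x / 2) = s at *
    generalize Real.cos ((m + 1) * x / 2) = c at *
    generalize Real.sin (x / 2) = a at *
    generalize Real.cos (x / 2) = b at *
    -- What remains is `s² + (2scb + (2c² - 1)a)a = (sb + ca)²`, modulo the two Pythagorean
    -- identities.
    linear_combination a ^ 2 * h3 - s ^ 2 * h4

/-- This trigonometric polynomial form has no case distinction: it yields continuity, periodicity,
the integral and the link with Fourier series. -/
theorem fejerKernel_eq_sum (m : ℕ) (x : ℝ) :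
    fejerKernel m x = 1 / (m + 1) * ∑ j ∈ Finset.range (m + 1), ∑ p ∈ Finset.range (j + 1),
      dirichletWeight p * Real.cos (p * x) := by
  have hm : (m : ℝ) + 1 ≠ 0 := by positivity
  unfold fejerKernel
  split_ifs with h
  · obtain ⟨k, rfl⟩ := h
    -- At multiples of `2π` all cosines are `1`: the Dirichlet kernels equal `2j + 1`, and the first
    -- `m + 1` odd numbers sum to `(m + 1)²`.
    have hcos : ∀ p : ℕ, Real.cos (p * (2 * k * Real.pi)) = 1 := fun p => by
      have := Real.cos_int_mul_two_pi (p * k)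
      push_cast at this
      rw [← this]
      congr 1
      ring
    have hD : ∀ j : ℕ, ∑ p ∈ Finset.range (j + 1), dirichletWeight p = 2 * j + 1 := fun j => by
      induction j with
      | zero => simp [dirichletWeight]
      | succ j ih =>
        rw [Finset.sum_range_succ, ih]
        simp only [dirichletWeight, Nat.succ_ne_zero, if_false]
        push_cast
        ring
    have hS : ∀ n : ℕ, ∑ j ∈ Finset.range (n + 1), (2 * (j : ℝ) + 1) = (n + 1) ^ 2 := fun n => by
      induction n with
      | zero => simp
      | succ n ih =>
        rw [Finset.sum_range_succ, ih]
        push_cast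
        ring
    simp only [hcos, mul_one, hD, hS]
    field_simp
  · rw [exists_int_eq_iff_sin_half_eq_zero] at h
    have h1 := sum_sin_mul_sin_half m x
    simp only [← dirichlet_sum_mul_sin_half, ← Finset.sum_mul] at h1
    rw [← h1]
    generalize ∑ j ∈ Finset.range (m + 1), ∑ p ∈ Finset.range (j + 1),
      dirichletWeight p * Real.cos (p * x) = S
    field_simp

theorem continuous_fejerKernel (m : ℕ) : Continuous (fejerKernel m) := by
  rw [funext (fejerKernel_eq_sum m)]
  fun_prop

theorem fejerKernel_nonneg (m : ℕ) (x : ℝ) : 0 ≤ fejerKernel m x := by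
  unfold fejerKernel
  split_ifs <;> positivity

theorem periodic_fejerKernel (m : ℕ) : Function.Periodic (fejerKernel m) (2 * Real.pi) := by
  intro x
  simp only [fejerKernel_eq_sum, mul_add, Real.cos_add_nat_mul_two_pi]

theorem integral_cos_nat_mul {p : ℕ} (hp : p ≠ 0) :
    ∫ x in (-Real.pi)..Real.pi, Real.cos (p * x) = 0 := by
  have hp' : (p : ℝ) ≠ 0 := Nat.cast_ne_zero.2 hp
  rw [intervalIntegral.integral_comp_mul_left _ hp', integral_cos]
  simp [Real.sin_nat_mul_pi]

theorem integral_dirichletWeight_mul_cos (p : ℕ) :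
    ∫ x in (-Real.pi)..Real.pi, dirichletWeight p * Real.cos (p * x) =
      if p = 0 then 2 * Real.pi else 0 := by
  split_ifs with h
  · subst h
    simp [dirichletWeight]
    ring
  · rw [intervalIntegral.integral_const_mul, integral_cos_nat_mul h, mul_zero]

theorem integral_fejerKernel (m : ℕ) :
    ∫ x in (-Real.pi)..Real.pi, fejerKernel m x = 2 * Real.pi := by
  have hm : (m : ℝ) + 1 ≠ 0 := by positivity
  simp only [fejerKernel_eq_sum]
  rw [intervalIntegral.integral_const_mul, intervalIntegral.integral_finsetSum
    fun j _ => (by fun_prop : Continuous _).intervalIntegrable _ _]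
  have h : ∀ j : ℕ, ∫ x in (-Real.pi)..Real.pi, ∑ p ∈ Finset.range (j + 1),
      dirichletWeight p * Real.cos (p * x) = 2 * Real.pi := fun j => by
    rw [intervalIntegral.integral_finsetSum
      fun j _ => (by fun_prop : Continuous _).intervalIntegrable _ _]
    simp only [integral_dirichletWeight_mul_cos]
    simp
  simp only [h, Finset.sum_const, Finset.card_range, nsmul_eq_mul]
  push_cast
  field_simp

/-- The factor `1 - cos x = 2 sin²(x/2)` cancels the singular denominator. This is the quantitative
form of concentration at `0`. -/
theorem fejerKernel_mul_one_sub_cos_le (m : ℕ) (x : ℝ) :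
    fejerKernel m x * (1 - Real.cos x) ≤ 2 / (m + 1) := by
  have hx : 1 - Real.cos x = 2 * Real.sin (x / 2) ^ 2 := by
    rw [Real.sin_sq_eq_half_sub, mul_div_cancel₀ x two_ne_zero]
    ring
  rw [hx]
  unfold fejerKernel
  split_ifs with h
  · rw [(exists_int_eq_iff_sin_half_eq_zero x).1 h]
    simp
    positivity
  · rw [exists_int_eq_iff_sin_half_eq_zero] at h
    have h1 : Real.sin ((m + 1) * x / 2) ^ 2 ≤ 1 := Real.sin_sq_le_one _
    have hm : (0 : ℝ) < m + 1 := by positivity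
    rw [show Real.sin ((m + 1) * x / 2) ^ 2 / ((m + 1) * Real.sin (x / 2) ^ 2) *
      (2 * Real.sin (x / 2) ^ 2) = 2 * Real.sin ((m + 1) * x / 2) ^ 2 / (m + 1) by field_simp]
    gcongr
    linarith

/-! ### Kernel averages and Cesàro means -/

open MeasureTheory in
theorem integral_planeRect_piSquare {h : ℝ × ℝ → ℝ} (hh : Continuous h) :
    ∫ w in planeRect piSquare, h w =
      ∫ y in (-Real.pi)..Real.pi, ∫ x in (-Real.pi)..Real.pi, h (x, y) := by
  have hπ : -Real.pi ≤ Real.pi := (neg_lt_self Real.pi_pos).le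
  have hi := hh.integrableOn_planeRect piSquare
  simp only [intervalIntegral.integral_of_le hπ]
  simp only [planeRect, piSquare, Measure.volume_eq_prod, IntegrableOn,
    ← Measure.prod_restrict] at hi ⊢
  exact integral_prod_symm h hi

/-- The average of `h` over the square `[-π,π]²` against the kernel `φ_m(u) φ_n(v)`. -/
def fejerMean (m n : ℕ) (h : ℝ × ℝ → ℝ) : ℝ :=
  1 / (4 * Real.pi ^ 2) *
    ∫ w in planeRect piSquare, fejerKernel m w.1 * fejerKernel n w.2 * h w

theorem Continuous.fejerKernel_mul {h : ℝ × ℝ → ℝ} (hh : Continuous h) (m n : ℕ) :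
    Continuous fun w : ℝ × ℝ => fejerKernel m w.1 * fejerKernel n w.2 * h w :=
  (((continuous_fejerKernel m).comp continuous_fst).mul
    ((continuous_fejerKernel n).comp continuous_snd)).mul hh

theorem intervalIntegral_comp_sub_of_periodic {F : ℝ → ℝ}
    (hF : Function.Periodic F (2 * Real.pi)) (x : ℝ) :
    ∫ u in (-Real.pi)..Real.pi, F (x - u) = ∫ u in (-Real.pi)..Real.pi, F u := by
  rw [intervalIntegral.integral_comp_sub_left]
  have h := hF.intervalIntegral_add_eq (x - Real.pi) (-Real.pi)
  rw [show x - Real.pi + 2 * Real.pi = x - -Real.pi by ring,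
    show -Real.pi + 2 * Real.pi = Real.pi by ring] at h
  exact h

/-- Substitution in one variable at a time; the integral over a full period is unaffected by the
shift. With the translation on the kernel, `h` appears as in the Fourier coefficients. -/
theorem fejerMean_comp_sub {h : ℝ × ℝ → ℝ} (hh : Continuous h)
    (h1 : ∀ y, Function.Periodic (fun x => h (x, y)) (2 * Real.pi))
    (h2 : ∀ x, Function.Periodic (fun y => h (x, y)) (2 * Real.pi)) (m n : ℕ) (z : ℝ × ℝ) :
    fejerMean m n (fun w => h (z.1 - w.1, z.2 - w.2)) =
      1 / (4 * Real.pi ^ 2) * ∫ w in planeRect piSquare,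
        fejerKernel m (z.1 - w.1) * fejerKernel n (z.2 - w.2) * h w := by
  have hm := continuous_fejerKernel m
  have hn := continuous_fejerKernel n
  rw [fejerMean, integral_planeRect_piSquare (by fun_prop), integral_planeRect_piSquare (by fun_prop)]
  congr 1
  have inner : ∀ v : ℝ,
      ∫ u in (-Real.pi)..Real.pi, fejerKernel m u * fejerKernel n v * h (z.1 - u, z.2 - v) =
      ∫ u in (-Real.pi)..Real.pi,
        fejerKernel m (z.1 - u) * fejerKernel n v * h (u, z.2 - v) := by
    intro v
    rw [← intervalIntegral_comp_sub_of_periodic (F := fun u =>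
      fejerKernel m (z.1 - u) * fejerKernel n v * h (u, z.2 - v)) ?_ z.1]
    · simp only [sub_sub_cancel]
    · intro u
      have := (periodic_fejerKernel m).sub_eq (z.1 - u)
      simp only [h1 (z.2 - v) u, ← sub_sub, this]
  simp only [inner]
  rw [← intervalIntegral_comp_sub_of_periodic (F := fun v => ∫ u in (-Real.pi)..Real.pi,
    fejerKernel m (z.1 - u) * fejerKernel n (z.2 - v) * h (u, v)) ?_ z.2]
  · simp only [sub_sub_cancel]
  · intro v
    have := (periodic_fejerKernel n).sub_eq (z.2 - v)
    simp only [h2 _ v, ← sub_sub, this]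

theorem fourierCoeff₂_eq_setIntegral {p q : ℝ → ℝ} (hp : Continuous p) (hq : Continuous q)
    {h : ℝ × ℝ → ℝ} (hh : Continuous h) (j k : ℕ) :
    fourierCoeff₂ p q h j k = 1 / Real.pi ^ 2 *
      ∫ w in planeRect piSquare, h w * p (j * w.1) * q (k * w.2) := by
  rw [fourierCoeff₂, integral_planeRect_piSquare (by fun_prop)]

open MeasureTheory in
theorem integral_cos_mul_cos_mul {h : ℝ × ℝ → ℝ} (hh : Continuous h) (z : ℝ × ℝ) (j k : ℕ) :
    1 / Real.pi ^ 2 * ∫ w in planeRect piSquare,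
        Real.cos (j * (z.1 - w.1)) * Real.cos (k * (z.2 - w.2)) * h w =
      fourierCoeff₂ Real.cos Real.cos h j k * Real.cos (j * z.1) * Real.cos (k * z.2) +
      fourierCoeff₂ Real.cos Real.sin h j k * Real.cos (j * z.1) * Real.sin (k * z.2) +
      fourierCoeff₂ Real.sin Real.cos h j k * Real.sin (j * z.1) * Real.cos (k * z.2) +
      fourierCoeff₂ Real.sin Real.sin h j k * Real.sin (j * z.1) * Real.sin (k * z.2) := by
  have hi : ∀ F : ℝ × ℝ → ℝ, Continuous F → Integrable F (volume.restrict (planeRect piSquare)) :=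
    fun F hF => hF.integrableOn_planeRect piSquare
  have hc := Real.continuous_cos
  have hs := Real.continuous_sin
  have hexp : ∀ w : ℝ × ℝ,
      Real.cos (j * (z.1 - w.1)) * Real.cos (k * (z.2 - w.2)) * h w =
      Real.cos (j * z.1) * Real.cos (k * z.2) * (h w * Real.cos (j * w.1) * Real.cos (k * w.2)) +
      Real.cos (j * z.1) * Real.sin (k * z.2) * (h w * Real.cos (j * w.1) * Real.sin (k * w.2)) +
      Real.sin (j * z.1) * Real.cos (k * z.2) * (h w * Real.sin (j * w.1) * Real.cos (k * w.2)) +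
      Real.sin (j * z.1) * Real.sin (k * z.2) *
        (h w * Real.sin (j * w.1) * Real.sin (k * w.2)) := by
    intro w
    rw [mul_sub, mul_sub, Real.cos_sub, Real.cos_sub]
    ring
  simp only [hexp]
  rw [integral_add (hi _ (by fun_prop)) (hi _ (by fun_prop)),
    integral_add (hi _ (by fun_prop)) (hi _ (by fun_prop)),
    integral_add (hi _ (by fun_prop)) (hi _ (by fun_prop))]
  simp only [integral_const_mul, fourierCoeff₂_eq_setIntegral hc hc hh,
    fourierCoeff₂_eq_setIntegral hc hs hh, fourierCoeff₂_eq_setIntegral hs hc hh,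
    fourierCoeff₂_eq_setIntegral hs hs hh]
  ring

open MeasureTheory in
-- The factors `1/4`, `1/2`, `1` of the series are the product of the two Dirichlet weights divided
-- by `4`; at a zero index the sine terms vanish.
theorem fourierTerm₂_eq_integral {h : ℝ × ℝ → ℝ} (hh : Continuous h) (z : ℝ × ℝ) (p q : ℕ) :
    fourierTerm₂ h z p q = 1 / (4 * Real.pi ^ 2) * ∫ w in planeRect piSquare,
      (dirichletWeight p * Real.cos (p * (z.1 - w.1))) *
        (dirichletWeight q * Real.cos (q * (z.2 - w.2))) * h w := by
  have hπ := Real.pi_ne_zero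
  have h1 : ∀ w : ℝ × ℝ, (dirichletWeight p * Real.cos (p * (z.1 - w.1))) *
      (dirichletWeight q * Real.cos (q * (z.2 - w.2))) * h w =
      dirichletWeight p * dirichletWeight q *
        (Real.cos (p * (z.1 - w.1)) * Real.cos (q * (z.2 - w.2)) * h w) := fun w => by ring
  simp only [h1, integral_const_mul]
  have h2 := integral_cos_mul_cos_mul hh z p q
  generalize ∫ w in planeRect piSquare,
    Real.cos (p * (z.1 - w.1)) * Real.cos (q * (z.2 - w.2)) * h w = A at h2 ⊢
  have h3 : 1 / (4 * Real.pi ^ 2) * (dirichletWeight p * dirichletWeight q * A) =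
      dirichletWeight p * dirichletWeight q / 4 * (1 / Real.pi ^ 2 * A) := by
    field_simp
  rw [h3, h2]
  unfold fourierTerm₂ dirichletWeight
  by_cases hp : p = 0 <;> by_cases hq : q = 0
  · subst hp hq
    simp
    ring
  · subst hp
    simp only [hq, Nat.cast_zero, zero_mul, Real.sin_zero, Real.cos_zero, if_true, if_false,
      and_false, mul_zero]
    ring
  · subst hq
    simp only [hp, Nat.cast_zero, zero_mul, Real.sin_zero, Real.cos_zero, if_true, if_false,
      false_and, mul_zero]
    ring
  · simp only [hp, hq, if_false, false_and]
    ring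

open MeasureTheory in
theorem fejerMean_comp_sub_eq_cesaroMean₂ {h : ℝ × ℝ → ℝ} (hh : Continuous h)
    (h1 : ∀ y, Function.Periodic (fun x => h (x, y)) (2 * Real.pi))
    (h2 : ∀ x, Function.Periodic (fun y => h (x, y)) (2 * Real.pi)) (m n : ℕ) (z : ℝ × ℝ) :
    fejerMean m n (fun w => h (z.1 - w.1, z.2 - w.2)) = cesaroMean₂ (fourierTerm₂ h z) m n := by
  rw [fejerMean_comp_sub hh h1 h2, cesaroMean₂]
  have hexp : ∀ w : ℝ × ℝ, fejerKernel m (z.1 - w.1) * fejerKernel n (z.2 - w.2) * h w =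
      1 / ((m + 1) * (n + 1)) * ∑ j ∈ Finset.range (m + 1), ∑ k ∈ Finset.range (n + 1),
        ∑ p ∈ Finset.range (j + 1), ∑ q ∈ Finset.range (k + 1),
        (dirichletWeight p * Real.cos (p * (z.1 - w.1))) *
        (dirichletWeight q * Real.cos (q * (z.2 - w.2))) * h w := by
    intro w
    simp only [fejerKernel_eq_sum, ← Finset.sum_mul, ← Finset.sum_mul_sum]
    rw [mul_mul_mul_comm, one_div_mul_one_div, mul_assoc _ _ (h w)]
  have hi : ∀ F : ℝ × ℝ → ℝ, Continuous F → Integrable F (volume.restrict (planeRect piSquare)) :=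
    fun F hF => hF.integrableOn_planeRect piSquare
  simp only [hexp, integral_const_mul, fourierTerm₂_eq_integral hh]
  rw [mul_left_comm]
  congr 1
  rw [integral_finsetSum _ fun j _ => hi _ (by fun_prop), Finset.mul_sum]
  refine Finset.sum_congr rfl fun j _ => ?_
  rw [integral_finsetSum _ fun k _ => hi _ (by fun_prop), Finset.mul_sum]
  refine Finset.sum_congr rfl fun k _ => ?_
  rw [integral_finsetSum _ fun p _ => hi _ (by fun_prop), Finset.mul_sum]
  refine Finset.sum_congr rfl fun p _ => ?_
  rw [integral_finsetSum _ fun q _ => hi _ (by fun_prop), Finset.mul_sum]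

/-! ### The Fejér mean as a positive functional -/

section FejerMean

variable {h h' : ℝ × ℝ → ℝ}

open MeasureTheory in
theorem fejerMean_add (hh : Continuous h) (hh' : Continuous h') (m n : ℕ) :
    fejerMean m n (fun w => h w + h' w) = fejerMean m n h + fejerMean m n h' := by
  simp only [fejerMean, mul_add]
  rw [integral_add ((hh.fejerKernel_mul m n).integrableOn_planeRect _)
    ((hh'.fejerKernel_mul m n).integrableOn_planeRect _), mul_add]

theorem fejerMean_const_mul (c : ℝ) (h : ℝ × ℝ → ℝ) (m n : ℕ) :
    fejerMean m n (fun w => c * h w) = c * fejerMean m n h := by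
  simp only [fejerMean, mul_left_comm _ c, MeasureTheory.integral_const_mul]

theorem fejerMean_const (c : ℝ) (m n : ℕ) : fejerMean m n (fun _ => c) = c := by
  have hπ := Real.pi_ne_zero
  rw [fejerMean, integral_planeRect_piSquare (continuous_const.fejerKernel_mul m n)]
  simp only [intervalIntegral.integral_mul_const, intervalIntegral.integral_const_mul,
    integral_fejerKernel]
  field_simp
  norm_num

theorem fejerMean_mono (hh : Continuous h) (hh' : Continuous h') (m n : ℕ)
    (hle : ∀ w ∈ planeRect piSquare, h w ≤ h' w) : fejerMean m n h ≤ fejerMean m n h' := by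
  refine mul_le_mul_of_nonneg_left (MeasureTheory.setIntegral_mono_on
    ((hh.fejerKernel_mul m n).integrableOn_planeRect _)
    ((hh'.fejerKernel_mul m n).integrableOn_planeRect _) (measurableSet_planeRect _)
    fun w hw => ?_) (by positivity)
  exact mul_le_mul_of_nonneg_left (hle w hw)
    (mul_nonneg (fejerKernel_nonneg m _) (fejerKernel_nonneg n _))

/-- Positivity and additivity applied to `h ≤ b + h'` and `h' ≤ b + h`. -/
theorem abs_fejerMean_sub_le (hh : Continuous h) (hh' : Continuous h') {b : ℝ × ℝ → ℝ}
    (hb : Continuous b) (m n : ℕ) (hle : ∀ w ∈ planeRect piSquare, |h w - h' w| ≤ b w) :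
    |fejerMean m n h - fejerMean m n h'| ≤ fejerMean m n b := by
  rw [abs_sub_le_iff]
  constructor
  · rw [sub_le_iff_le_add, ← fejerMean_add hb hh']
    exact fejerMean_mono hh (hb.add hh') m n fun w hw =>
      sub_le_iff_le_add.1 (abs_sub_le_iff.1 (hle w hw)).1
  · rw [sub_le_iff_le_add, ← fejerMean_add hb hh]
    exact fejerMean_mono hh' (hb.add hh) m n fun w hw =>
      sub_le_iff_le_add.1 (abs_sub_le_iff.1 (hle w hw)).2

theorem fejerMean_one_sub_cos_fst_le (m n : ℕ) :
    fejerMean m n (fun w => 1 - Real.cos w.1) ≤ 2 / (m + 1) := by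
  have hπ := Real.pi_ne_zero
  have hn := continuous_fejerKernel n
  have hmean : 1 / (4 * Real.pi ^ 2) *
      ∫ w in planeRect piSquare, 2 / ((m : ℝ) + 1) * fejerKernel n w.2 = 2 / (m + 1) := by
    rw [integral_planeRect_piSquare (by fun_prop)]
    simp only [intervalIntegral.integral_const, intervalIntegral.integral_const_mul, smul_eq_mul,
      integral_fejerKernel]
    field_simp
    ring
  -- The bound is written as an average, so that it suffices to dominate the first kernel factor
  -- pointwise while the second keeps its integral `2π`.
  rw [← hmean]
  refine mul_le_mul_of_nonneg_left (MeasureTheory.setIntegral_mono_on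
    (Continuous.integrableOn_planeRect
      (Continuous.fejerKernel_mul (by fun_prop) m n) _)
    (Continuous.integrableOn_planeRect (by fun_prop) _) (measurableSet_planeRect _)
    fun w _ => ?_) (by positivity)
  rw [mul_right_comm]
  exact mul_le_mul_of_nonneg_right (fejerKernel_mul_one_sub_cos_le m _) (fejerKernel_nonneg n _)

theorem fejerMean_one_sub_cos_snd_le (m n : ℕ) :
    fejerMean m n (fun w => 1 - Real.cos w.2) ≤ 2 / (n + 1) := by
  have hπ := Real.pi_ne_zero
  have hm := continuous_fejerKernel m
  have hmean : 1 / (4 * Real.pi ^ 2) *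
      ∫ w in planeRect piSquare, 2 / ((n : ℝ) + 1) * fejerKernel m w.1 = 2 / (n + 1) := by
    rw [integral_planeRect_piSquare (by fun_prop)]
    simp only [intervalIntegral.integral_const, intervalIntegral.integral_const_mul, smul_eq_mul,
      integral_fejerKernel]
    field_simp
    ring
  rw [← hmean]
  refine mul_le_mul_of_nonneg_left (MeasureTheory.setIntegral_mono_on
    (Continuous.integrableOn_planeRect
      (Continuous.fejerKernel_mul (by fun_prop) m n) _)
    (Continuous.integrableOn_planeRect (by fun_prop) _) (measurableSet_planeRect _)
    fun w _ => ?_) (by positivity)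
  rw [mul_assoc, mul_comm]
  exact mul_le_mul_of_nonneg_right (fejerKernel_mul_one_sub_cos_le n _) (fejerKernel_nonneg m _)

end FejerMean

/-! ### The Fejér operators on fuzzy functions -/

theorem isFuzzyC2Pi_const (u : FuzzyNumber) : IsFuzzyC2Pi fun _ => u :=
  ⟨continuous_const, fun _ _ _ => ⟨rfl, rfl⟩⟩

namespace IsFuzzyC2Pi

variable {f : ℝ × ℝ → FuzzyNumber}

theorem exists_dist_le (hf : IsFuzzyC2Pi f) : ∃ M : ℝ, 0 < M ∧ ∀ z z', dist (f z) (f z') ≤ M := by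
  obtain ⟨M, hM⟩ := bddAbove_Dstar hf (isFuzzyC2Pi_const 0)
  have hM' : ∀ z, dist (f z) 0 ≤ M := fun z => hM ⟨z, rfl⟩
  have h0 : 0 ≤ M := dist_nonneg.trans (hM' 0)
  refine ⟨2 * M + 1, by positivity, fun z z' => ?_⟩
  linarith [dist_triangle_right (f z) (f z') 0, hM' z, hM' z']

/-- Two points at distance less than `1` are moved by a common period into a period square enlarged
by `1` on each side, which is compact. -/
theorem uniformContinuous (hf : IsFuzzyC2Pi f) : UniformContinuous f := by
  have hK : IsCompact (Set.Icc (-1 : ℝ) (2 * Real.pi + 1) ×ˢ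
      Set.Icc (-1 : ℝ) (2 * Real.pi + 1)) := isCompact_Icc.prod isCompact_Icc
  have hred : ∀ x : ℝ, ∃ k : ℤ, x + 2 * k * Real.pi ∈ Set.Icc (0 : ℝ) (2 * Real.pi) := by
    intro x
    obtain ⟨k, hk, -⟩ := existsUnique_add_zsmul_mem_Ico Real.two_pi_pos x 0
    refine ⟨k, ?_⟩
    rw [show x + 2 * k * Real.pi = x + k • (2 * Real.pi) by rw [zsmul_eq_mul]; ring]
    simpa using Set.Ico_subset_Icc_self hk
  rw [Metric.uniformContinuous_iff]
  intro ε hε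
  obtain ⟨δ, hδ, h⟩ := Metric.uniformContinuousOn_iff.1
    (hK.uniformContinuousOn_of_continuous hf.continuous.continuousOn) ε hε
  refine ⟨min δ 1, by positivity, ?_⟩
  rintro ⟨a, b⟩ ⟨a', b'⟩ hd
  obtain ⟨j, hj⟩ := hred a
  obtain ⟨k, hk⟩ := hred b
  rw [Prod.dist_eq, max_lt_iff, lt_min_iff, lt_min_iff, Real.dist_eq, Real.dist_eq] at hd
  obtain ⟨⟨ha, ha1⟩, hb, hb1⟩ := hd
  rw [abs_lt] at ha1 hb1
  have := h (a + 2 * j * Real.pi, b + 2 * k * Real.pi)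
    ⟨⟨by linarith [hj.1], by linarith [hj.2]⟩, ⟨by linarith [hk.1], by linarith [hk.2]⟩⟩
    (a' + 2 * j * Real.pi, b' + 2 * k * Real.pi)
    ⟨⟨by linarith [hj.1], by linarith [hj.2]⟩, ⟨by linarith [hk.1], by linarith [hk.2]⟩⟩
    (by
      rw [Prod.dist_eq, Real.dist_eq, Real.dist_eq]
      simp only [add_sub_add_right_eq_sub]
      exact max_lt ha hb)
  simpa only [(hf.periodic _ _ _).1, (hf.periodic _ _ _).2] using this

/-- A modulus of continuity adapted to the Korovkin test functions `1 - cos`. -/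
theorem exists_dist_sub_le (hf : IsFuzzyC2Pi f) {ε : ℝ} (hε : 0 < ε) :
    ∃ C : ℝ, 0 ≤ C ∧ ∀ z, ∀ w ∈ planeRect piSquare,
      dist (f (z.1 - w.1, z.2 - w.2)) (f z) ≤
        ε + (C * (1 - Real.cos w.1) + C * (1 - Real.cos w.2)) := by
  obtain ⟨M, hM0, hM⟩ := hf.exists_dist_le
  obtain ⟨δ', hδ', hunif⟩ := Metric.uniformContinuous_iff.1 hf.uniformContinuous ε hε
  -- With `δ ≤ π` the cosine decreases on `[0,π]`, so `1 - cos t ≥ 1 - cos δ > 0` for `δ ≤ |t| ≤ π`.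
  -- Hence `C = M / (1 - cos δ)` absorbs the global oscillation `M` away from `0`.
  obtain ⟨δ, hδ, hδle⟩ : ∃ δ, 0 < δ ∧ δ ≤ δ' ∧ δ ≤ Real.pi :=
    ⟨min δ' Real.pi, lt_min hδ' Real.pi_pos, min_le_left _ _, min_le_right _ _⟩
  have hcos : 0 < 1 - Real.cos δ := by
    have := Real.cos_lt_cos_of_nonneg_of_le_pi le_rfl hδle.2 hδ
    rw [Real.cos_zero] at this
    linarith
  have hfar : ∀ t ∈ Set.Ioc (-Real.pi) Real.pi, δ ≤ |t| →
      M ≤ M / (1 - Real.cos δ) * (1 - Real.cos t) := by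
    intro t ht hδt
    rw [div_mul_eq_mul_div, le_div_iff₀ hcos, ← Real.cos_abs t]
    have := Real.cos_le_cos_of_nonneg_of_le_pi hδ.le (abs_le.2 ⟨ht.1.le, ht.2⟩) hδt
    gcongr
  have hC : 0 ≤ M / (1 - Real.cos δ) := by positivity
  have hnn : ∀ t : ℝ, 0 ≤ M / (1 - Real.cos δ) * (1 - Real.cos t) := fun t =>
    mul_nonneg hC (sub_nonneg.2 (Real.cos_le_one t))
  refine ⟨M / (1 - Real.cos δ), hC, fun z w hw => ?_⟩
  have n1 := hnn w.1
  have n2 := hnn w.2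
  by_cases h1 : δ ≤ |w.1|
  · linarith [hM (z.1 - w.1, z.2 - w.2) z, hfar w.1 hw.1 h1]
  by_cases h2 : δ ≤ |w.2|
  · linarith [hM (z.1 - w.1, z.2 - w.2) z, hfar w.2 hw.2 h2]
  have : dist (f (z.1 - w.1, z.2 - w.2)) (f z) < ε := by
    refine hunif ?_
    rw [Prod.dist_eq, Real.dist_eq, Real.dist_eq]
    simp only [sub_sub_cancel_left, abs_neg]
    exact max_lt ((not_le.1 h1).trans_le hδle.1) ((not_le.1 h2).trans_le hδle.1)
  linarith

theorem continuous_fejerIntegrand (hf : IsFuzzyC2Pi f) (m n : ℕ) (z : ℝ × ℝ) :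
    Continuous (fejerIntegrand m n f z) := by
  have hm := continuous_fejerKernel m
  have hn := continuous_fejerKernel n
  have hc := hf.continuous
  exact FuzzyNumber.continuous_smul_of_nonneg (by fun_prop) (by fun_prop)
    fun w => mul_nonneg (fejerKernel_nonneg m _) (fejerKernel_nonneg n _)

theorem endpoint_fuzzyFejer (hf : IsFuzzyC2Pi f) (m n : ℕ) (z : ℝ × ℝ) {e : FuzzyNumber → ℝ}
    (he : FuzzyNumber.IsEndpoint e) :
    e (fuzzyFejer m n f z) = fejerMean m n fun w => e (f (z.1 - w.1, z.2 - w.2)) := by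
  rw [fuzzyFejer, he.map_smul (by positivity),
    endpoint_fuzzyRiemannIntegral (hf.continuous_fejerIntegrand m n z) he, fejerMean]
  simp only [fejerIntegrand,
    he.map_smul (mul_nonneg (fejerKernel_nonneg m _) (fejerKernel_nonneg n _))]

theorem continuous_endpoint_comp_sub (hf : IsFuzzyC2Pi f) (z : ℝ × ℝ) {e : FuzzyNumber → ℝ}
    (he : FuzzyNumber.IsEndpoint e) :
    Continuous fun w : ℝ × ℝ => e (f (z.1 - w.1, z.2 - w.2)) := by
  have h1 := he.continuous
  have h2 := hf.continuous
  fun_prop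

theorem endpoint_fuzzyFejer_eq_cesaroMean₂ (hf : IsFuzzyC2Pi f) (m n : ℕ) (z : ℝ × ℝ)
    {e : FuzzyNumber → ℝ} (he : FuzzyNumber.IsEndpoint e) :
    e (fuzzyFejer m n f z) = cesaroMean₂ (fourierTerm₂ (fun w => e (f w)) z) m n := by
  rw [hf.endpoint_fuzzyFejer m n z he]
  refine fejerMean_comp_sub_eq_cesaroMean₂ (h := fun w => e (f w))
    (he.continuous.comp hf.continuous) (fun y x => ?_) (fun x y => ?_) m n z
  · simpa using congrArg e (hf.periodic x y 1).1
  · simpa using congrArg e (hf.periodic x y 1).2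

/-- Averaging against a nonnegative kernel of mean one does not increase a uniform distance, so the
operator inherits the modulus of continuity of `f`. -/
theorem dist_fuzzyFejer_le (hf : IsFuzzyC2Pi f) (m n : ℕ) {z z' : ℝ × ℝ} {ε : ℝ}
    (h : ∀ w : ℝ × ℝ,
      dist (f (z.1 - w.1, z.2 - w.2)) (f (z'.1 - w.1, z'.2 - w.2)) ≤ ε) :
    dist (fuzzyFejer m n f z) (fuzzyFejer m n f z') ≤ ε :=
  FuzzyNumber.dist_le_of_endpoints fun e he => by
    rw [hf.endpoint_fuzzyFejer m n z he, hf.endpoint_fuzzyFejer m n z' he]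
    exact (abs_fejerMean_sub_le (hf.continuous_endpoint_comp_sub z he)
      (hf.continuous_endpoint_comp_sub z' he) (continuous_const (y := ε)) m n
      fun w _ => (he.abs_sub_le _ _).trans (h w)).trans_eq (fejerMean_const ε m n)

theorem fuzzyFejer (hf : IsFuzzyC2Pi f) (m n : ℕ) : IsFuzzyC2Pi (fuzzyFejer m n f) where
  continuous := by
    rw [Metric.continuous_iff]
    intro z ε hε
    obtain ⟨δ, hδ, h⟩ := Metric.uniformContinuous_iff.1 hf.uniformContinuous (ε / 2) (half_pos hε)
    refine ⟨δ, hδ, fun z' hz' => ?_⟩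
    refine (hf.dist_fuzzyFejer_le m n fun w => (h ?_).le).trans_lt (half_lt_self hε)
    rw [Prod.dist_eq] at hz' ⊢
    simpa only [dist_sub_right] using hz'
  periodic x y k := by
    have h1 : fejerIntegrand m n f (x + 2 * k * Real.pi, y) = fejerIntegrand m n f (x, y) := by
      funext w
      simp only [fejerIntegrand, add_sub_right_comm, (hf.periodic _ _ _).1]
    have h2 : fejerIntegrand m n f (x, y + 2 * k * Real.pi) = fejerIntegrand m n f (x, y) := by
      funext w
      simp only [fejerIntegrand, add_sub_right_comm, (hf.periodic _ _ _).2]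
    simp only [_root_.fuzzyFejer, h1, h2, and_self]

theorem exists_dist_fuzzyFejer_self_le (hf : IsFuzzyC2Pi f) {ε : ℝ} (hε : 0 < ε) :
    ∃ C : ℝ, ∀ (m n : ℕ) (z : ℝ × ℝ),
      dist (_root_.fuzzyFejer m n f z) (f z) ≤ ε + (C * (2 / (m + 1)) + C * (2 / (n + 1))) := by
  obtain ⟨C, hC, h⟩ := hf.exists_dist_sub_le hε
  refine ⟨C, fun m n z => FuzzyNumber.dist_le_of_endpoints fun e he => ?_⟩
  -- Writing `e (f z)` as the mean of a constant turns the error into a difference of two means.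
  rw [hf.endpoint_fuzzyFejer m n z he, ← fejerMean_const (e (f z)) m n]
  refine (abs_fejerMean_sub_le (hf.continuous_endpoint_comp_sub z he) continuous_const
    (b := fun w => ε + (C * (1 - Real.cos w.1) + C * (1 - Real.cos w.2))) (by fun_prop) m n
    fun w hw => (he.abs_sub_le _ _).trans (h z w hw)).trans ?_
  rw [fejerMean_add (by fun_prop) (by fun_prop), fejerMean_add (by fun_prop) (by fun_prop),
    fejerMean_const, fejerMean_const_mul, fejerMean_const_mul]
  gcongr
  · exact fejerMean_one_sub_cos_fst_le m n
  · exact fejerMean_one_sub_cos_snd_le m n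

theorem tendsto_Dstar_fuzzyFejer (hf : IsFuzzyC2Pi f) :
    Tendsto (fun p : ℕ × ℕ => Dstar (_root_.fuzzyFejer p.1 p.2 f) f) atTop (𝓝 0) := by
  have hnn : ∀ p : ℕ × ℕ, 0 ≤ Dstar (_root_.fuzzyFejer p.1 p.2 f) f := fun p =>
    Real.iSup_nonneg fun z => dist_nonneg (x := _root_.fuzzyFejer p.1 p.2 f z)
  refine tendsto_order.2 ⟨fun a ha => Eventually.of_forall fun p => ha.trans_le (hnn p),
    fun ε hε => ?_⟩
  obtain ⟨C, hC⟩ := hf.exists_dist_fuzzyFejer_self_le (half_pos hε)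
  have hlim : Tendsto (fun k : ℕ => C * (2 / ((k : ℝ) + 1))) atTop (𝓝 0) := by
    simpa [div_eq_mul_inv] using
      ((tendsto_one_div_add_atTop_nhds_zero_nat (𝕜 := ℝ)).const_mul 2).const_mul C
  have hsum : Tendsto (fun p : ℕ × ℕ =>
      ε / 2 + (C * (2 / ((p.1 : ℝ) + 1)) + C * (2 / ((p.2 : ℝ) + 1)))) atTop
      (𝓝 (ε / 2 + (0 + 0))) := by
    -- `atTop` on `ℕ × ℕ` is the product filter: both indices grow independently.
    rw [← prod_atTop_atTop_eq]
    exact tendsto_const_nhds.add ((hlim.comp tendsto_fst).add (hlim.comp tendsto_snd))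
  filter_upwards [hsum.eventually_lt_const (u := ε) (by linarith)] with p hp
  exact (ciSup_le fun z => hC p.1 p.2 z).trans_lt hp

end IsFuzzyC2Pi

end

theorem mainTheorem5 (f : ℝ × ℝ → FuzzyNumber) (hf : IsFuzzyC2Pi f) :
    (∀ (m n : ℕ) (z : ℝ × ℝ),
      HasFuzzyRiemannIntegral piSquare (fejerIntegrand m n f z)
        (fuzzyRiemannIntegral piSquare (fejerIntegrand m n f z))) ∧
    (∀ m n : ℕ, IsFuzzyC2Pi (fuzzyFejer m n f)) ∧
    (∀ (m n : ℕ) (z : ℝ × ℝ), ∀ α ∈ Set.Icc (0 : ℝ) 1,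
      (fuzzyFejer m n f z).lower α =
          cesaroMean₂ (fourierTerm₂ (fun w => (f w).lower α) z) m n ∧
        (fuzzyFejer m n f z).upper α =
          cesaroMean₂ (fourierTerm₂ (fun w => (f w).upper α) z) m n) ∧
    Tendsto (fun p : ℕ × ℕ => Dstar (fuzzyFejer p.1 p.2 f) f) atTop (𝓝 0) :=
  ⟨fun m n z => hasFuzzyRiemannIntegral_fuzzyRiemannIntegral (hf.continuous_fejerIntegrand m n z),
    hf.fuzzyFejer,
    fun m n z _ hα =>
      ⟨hf.endpoint_fuzzyFejer_eq_cesaroMean₂ m n z (FuzzyNumber.isEndpoint_lower hα),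
        hf.endpoint_fuzzyFejer_eq_cesaroMean₂ m n z (FuzzyNumber.isEndpoint_upper hα)⟩,
    hf.tendsto_Dstar_fuzzyFejer⟩
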